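/- **Setting.** Let $d,\nu\ge 1$, $\mathbb T=\mathbb R/2\pi\mathbb Z$, $\Lambda=[1/2,3/2]$, $\tau>0$. On integer vectors, $|\cdot|$ is the sup-norm and $\|\cdot\|$ the Euclidean norm; $\mathrm d$ is the sup-distance. Let $V\in C(\mathbb T^d;\mathbb R)$ satisfy $\mathrm{Ker}(-\Delta+V)=0$. Let $m$ be the average of $V$, $V_0=V-m$, let $n^-$ be the number of negative eigenvalues of $-\Delta+V$ on $L^2(\mathbb T^d)$ (with multiplicity), and let $\beta_0=\min\{|\mu^-|/2,\mu^+\}$, where $\mu^-$ is the largest negative and $\mu^+$ the smallest positive eigenvalue (if $n^-=0$, $\beta_0=\mu^+$). For finite nonempty $B\subset\mathbb Z^d$ let $(-\Delta+V)_B$ be the compression of $-\Delta+V$ to $\mathrm{span}\{e^{\mathrm i j\cdot x}:j\in B\}$ and $\partial B=\{j\in B:\mathrm d(j,\mathbb Z^d\setminus B)=1\}$. Call $L_0\in\mathbb N$ *admissible* if for every such $B$ with $\mathrm d(0,\partial B)\ge L_0$: (1) if $B\cap\{|j|\le L_0-1\}=\emptyset$, then $(-\Delta+V)_B\ge\beta_0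 I$; (2) if $\{|j|\le L_0\}\subset B$, then $(-\Delta+V)_B$ has exactly $n^-$ negative eigenvalues, all $\le-\beta_0$, and its other eigenvalues are $\ge\beta_0$. Put $\mathcal Q_N=\{j\in\mathbb Z^d:\mathrm d(0,\partial(j+[-N,N]^d))<L_0\}$. Given $\bar\omega\in\mathbb R^\nu$, $\varepsilon\ge0$ and a $C^1$ map $\lambda\mapsto g(\lambda)$ from $\Lambda$ to $C(\mathbb T^{\nu}\times\mathbb T^d;\mathbb R)$ (for the linearized wave equation, $g=(\partial_uf)(\varphi,x,u(\lambda;\varphi,x))$), let $T_1(\lambda)$ be the matrix, in the basis $e^{\mathrm i(l\cdot\varphi+j\cdot x)}$, $(l,j)\in\mathbb Z^\nu\times\mathbb Z^d$, of multiplication by $g(\lambda)$, let $T_2$ be that of multiplication by $V_0(x)$, and let $$A(\varepsilon,\lambda,\theta)=\mathrm{diag}_{(l,j)}\big(-(\lambda\bar\omega\cdot l+\theta)^2+\|j\|^2+m\big)+T_2-\varepsilon T_1(\lambda).$$ Let $A_{N,j_0}(\varepsilon,\lambda,\theta)$ be its restriction to the indices $|l|\le N$, $|j-j_0|\le N$.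 Let $\|\cdot\|_0$ denote the $L^2$-operator norm, with $\|A^{-1}\|_0=\infty$ if $A$ is not invertible. **Lemma.** An admissible $L_0$ exists. Moreover there are $c,C>0$ and $N_0\in\mathbb N$, depending only on $V,d,\nu,\tau$, such that the following holds for every $\bar\omega\in\mathbb R^\nu$ with $\max_k|\bar\omega_k|\le1$, every $\varepsilon\ge0$, every $g$ as above with $$\varepsilon\big(\|T_1(\lambda)\|_0+\|\partial_\lambda T_1(\lambda)\|_0\big)\le c\qquad\text{for all }\lambda\in\Lambda,$$ every admissible $L_0$ and every integer $N\ge N_0$: for all $j_0\in\mathbb Z^d$ with $|j_0|<8N$ and $j_0\notin\mathcal Q_N$, the set $$\mathbf B^0_{2,N}(j_0)=\Big\{(\lambda,\theta)\in\Lambda\times\mathbb R:\ \big\|A_{N,j_0}^{-1}(\varepsilon,\lambda,\theta)\big\|_0>N^\tau/2\Big\}$$ has Lebesgue measure at most $C\,N^{-\tau+d+\nu+1}$. -/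

import Mathlib

open MeasureTheory
open scoped ENNReal ComplexConjugate ComplexOrder

noncomputable section

namespace QPWave

/-! Points of the torus `(ℝ / 2πℤ)^ι` are recorded by the rescaled coordinates `y = x / 2π` in
`UnitAddTorus ι = (ℝ / ℤ)^ι`.  The character `exp (i k · x)` is then `UnitAddTorus.mFourier k`, and
`UnitAddTorus.mFourierCoeff f k` is the coefficient `(2π)^{-n} ∫ f(x) exp (- i k · x) dx`, with
`n` the dimension.  Norms `‖j‖` of integer vectors are sup-norms. -/

/-- The normalised Lebesgue (Haar) measure on the torus. -/
def torusMeasure (ι : Type) [Fintype ι] : Measure (UnitAddTorus ι) :=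
  Measure.pi fun _ => AddCircle.haarAddCircle

/-- The squared Euclidean norm `j₁² + ⋯ + j_d²`. -/
def euclSq {d : ℕ} (j : Fin d → ℤ) : ℝ := ∑ k, (j k : ℝ) ^ 2

/-! ### Operator norms of matrices -/

/-- The `ℓ²` norm of a family of complex numbers, possibly infinite. -/
def l2norm {ι : Type} (h : ι → ℂ) : ℝ≥0∞ := (∑' i, ‖h i‖ₑ ^ 2) ^ (1 / 2 : ℝ)

/-- The `L²`-operator norm `‖M‖₀` of a matrix, finite or infinite, as the supremum of
`‖M h‖ / ‖h‖` over the nonzero finitely supported `h`. -/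
def opNorm {ι : Type} (M : Matrix ι ι ℂ) : ℝ≥0∞ :=
  ⨆ (h : ι →₀ ℂ) (_ : h ≠ 0), l2norm (fun i => h.sum fun k c => M i k * c) / l2norm (⇑h)

open Classical in
/-- `‖M⁻¹‖₀`, with the convention that it is `∞` when `M` is not invertible. -/
def invNorm {ι : Type} [Fintype ι] [DecidableEq ι] (M : Matrix ι ι ℂ) : ℝ≥0∞ :=
  if IsUnit M then opNorm M⁻¹ else ⊤

/-! ### The Schrödinger operator `-Δ + V` on the torus -/

/-- `(-Δ + V) u = μ u` for `u` in `L²`, in the sense of distributions on the torus (that is, tested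
against all the exponentials). For continuous `V` such a `u` is automatically in `H²`. -/
def SolvesEigen {d : ℕ} (V : C(UnitAddTorus (Fin d), ℝ)) (μ : ℝ)
    (u : Lp ℂ 2 (torusMeasure (Fin d))) : Prop :=
  ∀ j : Fin d → ℤ,
    (euclSq j : ℂ) * UnitAddTorus.mFourierCoeff (⇑u) j
      + UnitAddTorus.mFourierCoeff (fun x => (V x : ℂ) * u x) j
      = (μ : ℂ) * UnitAddTorus.mFourierCoeff (⇑u) j

/-- `Ker (-Δ + V) = 0`. -/
def TrivialKernel {d : ℕ} (V : C(UnitAddTorus (Fin d), ℝ)) : Prop :=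
  ∀ u, SolvesEigen V 0 u → u = 0

/-- `μ` is an eigenvalue of `-Δ + V`. -/
def IsEigenvalue {d : ℕ} (V : C(UnitAddTorus (Fin d), ℝ)) (μ : ℝ) : Prop :=
  ∃ u, u ≠ 0 ∧ SolvesEigen V μ u

/-- The number `n⁻` of negative eigenvalues of `-Δ + V`, counted with multiplicity: the dimension
of the span of the corresponding eigenfunctions. -/
def negCount {d : ℕ} (V : C(UnitAddTorus (Fin d), ℝ)) : ℕ :=
  Module.finrank ℂ (Submodule.span ℂ {u | ∃ μ : ℝ, μ < 0 ∧ SolvesEigen V μ u})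

/-- `β₀ = min {|μ⁻| / 2, μ⁺}`, with `μ⁻` the largest negative eigenvalue (this term is absent when
there is no negative eigenvalue) and `μ⁺` the smallest positive one. -/
def beta0 {d : ℕ} (V : C(UnitAddTorus (Fin d), ℝ)) : ℝ :=
  sInf {x | ∃ μ, IsEigenvalue V μ ∧ ((μ < 0 ∧ x = |μ| / 2) ∨ (0 < μ ∧ x = μ))}

/-- The matrix of `-Δ + V` in the exponential basis. -/
def schrodinger {d : ℕ} (V : C(UnitAddTorus (Fin d), ℝ)) :
    Matrix (Fin d → ℤ) (Fin d → ℤ) ℂ :=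
  fun j k => (if j = k then (euclSq j : ℂ) else 0)
    + UnitAddTorus.mFourierCoeff (fun x => (V x : ℂ)) (j - k)

/-- The matrix of `(-Δ + V)_B = Π_B (-Δ + V)` restricted to the span of `exp (i j · x)`, `j ∈ B`. -/
def schrodingerOn {d : ℕ} (V : C(UnitAddTorus (Fin d), ℝ)) (B : Finset (Fin d → ℤ)) :
    Matrix B B ℂ :=
  (schrodinger V).submatrix Subtype.val Subtype.val

theorem schrodingerOn_isHermitian {d : ℕ} (V : C(UnitAddTorus (Fin d), ℝ))
    (B : Finset (Fin d → ℤ)) : (schrodingerOn V B).IsHermitian := by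
  have key : ∀ n : Fin d → ℤ,
      conj (UnitAddTorus.mFourierCoeff (fun x => (V x : ℂ)) n)
        = UnitAddTorus.mFourierCoeff (fun x => (V x : ℂ)) (-n) := by
    intro n
    unfold UnitAddTorus.mFourierCoeff
    rw [← integral_conj]
    congr 1
    ext x
    simp [UnitAddTorus.mFourier_neg]
  ext j k
  simp only [schrodingerOn, schrodinger, Matrix.conjTranspose_apply, Matrix.submatrix_apply,
    RCLike.star_def, map_add, key, neg_sub]
  congr 1
  by_cases h : (j : Fin d → ℤ) = k
  · rw [if_pos h, if_pos h.symm, h, Complex.conj_ofReal]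
  · rw [if_neg h, if_neg (Ne.symm h), map_zero]

/-- `∂B`: the points of `B` at sup-distance `1` from the complement of `B`. -/
def bdry {d : ℕ} (B : Set (Fin d → ℤ)) : Set (Fin d → ℤ) :=
  {j | j ∈ B ∧ ∃ k, k ∉ B ∧ ‖j - k‖ = 1}

/-- The defining property of the integer `L₀`: for every finite nonempty `B ⊆ ℤ^d` with
`d(0, ∂B) ≥ L₀`,
* if `B` is disjoint from `{|j| ≤ L₀ - 1}`, then `(-Δ + V)_B ≥ β₀`;
* if `B` contains `{|j| ≤ L₀}`, then `(-Δ + V)_B` has exactly `n⁻` negative eigenvalues, all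
  `≤ -β₀`, and all its other eigenvalues are `≥ β₀`. -/
def IsSpectralRadius {d : ℕ} (V : C(UnitAddTorus (Fin d), ℝ)) (L : ℕ) : Prop :=
  ∀ B : Finset (Fin d → ℤ), B.Nonempty →
    (∀ j ∈ bdry (B : Set (Fin d → ℤ)), (L : ℝ) ≤ ‖j‖) →
    ((∀ j : Fin d → ℤ, ‖j‖ < L → j ∉ B) →
      (schrodingerOn V B - (beta0 V : ℂ) • (1 : Matrix B B ℂ)).PosSemidef) ∧
    ((∀ j : Fin d → ℤ, ‖j‖ ≤ L → j ∈ B) →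
      Fintype.card {k // (schrodingerOn_isHermitian V B).eigenvalues k < 0} = negCount V ∧
      ∀ k, (schrodingerOn_isHermitian V B).eigenvalues k ≤ -beta0 V ∨
        beta0 V ≤ (schrodingerOn_isHermitian V B).eigenvalues k)

/-- The box `j₀ + [-N, N]^d`. -/
def box {d : ℕ} (j₀ : Fin d → ℤ) (N : ℕ) : Finset (Fin d → ℤ) :=
  Finset.Icc (fun k => j₀ k - N) (fun k => j₀ k + N)

/-- `Q_N = {j : d(0, ∂(j + [-N, N]^d)) < L₀}`. -/
def badCentres (d L N : ℕ) : Set (Fin d → ℤ) :=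
  {j | ∃ k ∈ bdry (box j N : Set (Fin d → ℤ)), ‖k‖ < L}

/-! ### The linearised wave operator -/

/-- The indices `(l, j) ∈ ℤ^ν × ℤ^d`. -/
abbrev Idx (ν d : ℕ) : Type := (Fin ν → ℤ) × (Fin d → ℤ)

/-- The parameter interval `Λ = [1/2, 3/2]`. -/
def Lam : Set ℝ := Set.Icc (1 / 2) (3 / 2)

/-- The average of the potential. -/
def mean {d : ℕ} (V : C(UnitAddTorus (Fin d), ℝ)) : ℝ := ∫ x, V x ∂(torusMeasure (Fin d))

/-- `D(λ, θ) = diag (-(λ ω̄ · l + θ)² + ‖j‖² + m)`. -/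
def diagPart {ν d : ℕ} (V : C(UnitAddTorus (Fin d), ℝ)) (ω : Fin ν → ℝ) (lam θ : ℝ) :
    Matrix (Idx ν d) (Idx ν d) ℂ :=
  Matrix.diagonal fun i =>
    ((-(lam * (∑ k, ω k * (i.1 k : ℝ)) + θ) ^ 2 + euclSq i.2 + mean V : ℝ) : ℂ)

/-- `T₂`: the matrix of multiplication by `V₀ = V - m` on functions of `(φ, x)`. -/
def T2 (ν : ℕ) {d : ℕ} (V : C(UnitAddTorus (Fin d), ℝ)) : Matrix (Idx ν d) (Idx ν d) ℂ :=
  fun i i' => if i.1 = i'.1 then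
    UnitAddTorus.mFourierCoeff (fun x => ((V x - mean V : ℝ) : ℂ)) (i.2 - i'.2) else 0

/-- `T₁`: the (Töplitz) matrix of multiplication by a real function `g(φ, x)`. -/
def mulMatrix {ν d : ℕ} (g : C(UnitAddTorus (Fin ν ⊕ Fin d), ℝ)) :
    Matrix (Idx ν d) (Idx ν d) ℂ :=
  fun i i' => UnitAddTorus.mFourierCoeff (fun y => (g y : ℂ))
    (Sum.elim (i.1 - i'.1) (i.2 - i'.2))

/-- `A(ε, λ, θ) = D(λ, θ) + T₂ - ε T₁(λ)`, with `T₁(λ)` the multiplication by `g λ`. -/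
def fullMatrix {ν d : ℕ} (V : C(UnitAddTorus (Fin d), ℝ)) (ω : Fin ν → ℝ)
    (g : ℝ → C(UnitAddTorus (Fin ν ⊕ Fin d), ℝ)) (ε lam θ : ℝ) :
    Matrix (Idx ν d) (Idx ν d) ℂ :=
  diagPart V ω lam θ + (T2 ν V - (ε : ℂ) • mulMatrix (g lam))

/-- `A_{N, j₀}(ε, λ, θ)`: the restriction of `A` to `|l| ≤ N`, `|j - j₀| ≤ N`. -/
def boxMatrix {ν d : ℕ} (V : C(UnitAddTorus (Fin d), ℝ)) (ω : Fin ν → ℝ)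
    (g : ℝ → C(UnitAddTorus (Fin ν ⊕ Fin d), ℝ)) (ε : ℝ) (N : ℕ) (j₀ : Fin d → ℤ)
    (lam θ : ℝ) :
    Matrix (box (0 : Fin ν → ℤ) N ×ˢ box j₀ N : Finset (Idx ν d))
      (box (0 : Fin ν → ℤ) N ×ˢ box j₀ N : Finset (Idx ν d)) ℂ :=
  (fullMatrix V ω g ε lam θ).submatrix Subtype.val Subtype.val

end QPWave

end

/-! Put `θ = λη`. For fixed `η` the box matrix is `-λ²(ω·l + η)² + H - εT₁(λ)`, where `H` is the
compression of `-Δ + V` to the box in `j`. As `j₀ ∉ Q_N`, that box avoids `{|j| < L₀}` or contains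
`{|j| ≤ L₀}` (`box_dichotomy`), so admissibility gives `|h| ≥ β₀` for every eigenvalue `h` of `H`.
In the basis `e_l ⊗ ψ_k` the unperturbed part is diagonal with entries `-λ²y + h`, `y ≥ 0`.

These entries are nonincreasing in `λ`, but with no uniform rate, since `y` may vanish. A congruence
by a positive diagonal weight, `1/λ` where `h > 0` and `λ` where `h < 0`, turns them into `-y +
h/λ²` and `-λ⁴y + hλ²`, which decrease at rate at least `β₀/6` (`weighted_diagonal_le`). The small
Lipschitz perturbation costs at most half of this rate. For a symmetric family decreasing at rate
`r`, min-max shows that each ordered eigenvalue lies in `[-δ, δ]` only on a set of diameter at most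
`2δ/r` (`volume_setOf_norm_apply_le`); no regularity of the eigenvalues is needed. With
`(2N+1)^(ν+d)` eigenvalues and `δ = 2N^(-τ)`, each slice has measure `O(N^(-τ+d+ν))`.

If `|θ|` exceeds a suitable multiple of `N`, the term `-(λω·l + θ)²` dominates and the inverse has
norm at most `1/2` (`two_mul_norm_lt`). So `η` ranges over an interval of length `O(N)`, and Fubini
in `(λ, η)` supplies the last factor `N` (`volume_le_of_slices`).

An admissible `L₀` is any large integer. A box away from the origin sees only large `‖j‖²`, which
dominates `V`. On a box containing a large ball, truncating the negative eigenfunctions moves their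
form by at most `β₀‖u‖²`; as negative eigenvalues are at most `-2β₀`, this leaves `n⁻` eigenvalues
at most `-β₀`. Vectors orthogonal to the truncations are orthogonal to the eigenfunctions
themselves, so their form is at least `β₀` (`card_eigenvalues_section`). -/

noncomputable section

/-! ### Counting eigenvalues with quadratic forms -/

namespace OrthonormalBasis

variable {E : Type*} [NormedAddCommGroup E] [InnerProductSpace ℂ E] {ι : Type*} [Fintype ι]
  (b : OrthonormalBasis ι ℂ E) {T : E →ₗ[ℂ] E} {h : ι → ℝ}

theorem inner_apply_of_diagonal (hT : ∀ k, T (b k) = (h k : ℂ) • b k) (k : ι) (x : E) :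
    inner ℂ (b k) (T x) = h k * inner ℂ (b k) x := by
  classical
  conv_lhs => rw [← b.sum_repr' x]
  simp only [map_sum, map_smul, hT, inner_sum, inner_smul_right,
    orthonormal_iff_ite.mp b.orthonormal, mul_ite, mul_one, mul_zero, Finset.sum_ite_eq,
    Finset.mem_univ, if_true]
  ring

theorem inner_self_apply_of_diagonal (hT : ∀ k, T (b k) = (h k : ℂ) • b k) (x : E) :
    (inner ℂ x (T x)).re = ∑ k, h k * ‖inner ℂ (b k) x‖ ^ 2 := by
  rw [← b.sum_inner_mul_inner, Complex.re_sum]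
  refine Finset.sum_congr rfl fun k _ => ?_
  rw [b.inner_apply_of_diagonal hT, mul_left_comm, Complex.re_ofReal_mul,
    ← inner_conj_symm x (b k), ← Complex.normSq_eq_conj_mul_self, Complex.ofReal_re,
    Complex.normSq_eq_norm_sq]

theorem norm_apply_sq_of_diagonal (hT : ∀ k, T (b k) = (h k : ℂ) • b k) (x : E) :
    ‖T x‖ ^ 2 = ∑ k, h k ^ 2 * ‖inner ℂ (b k) x‖ ^ 2 := by
  rw [← b.sum_sq_norm_inner_right]
  refine Finset.sum_congr rfl fun k _ => ?_
  rw [b.inner_apply_of_diagonal hT, norm_mul, mul_pow, Complex.norm_real, Real.norm_eq_abs, sq_abs]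

/-- One half of Courant–Fischer. The coordinates with `h k ≤ a` determine a vector of `Y`: if they
all vanish, the form exceeds `a‖y‖²` unless `y = 0`. -/
theorem finrank_le_card_le (hT : ∀ k, T (b k) = (h k : ℂ) • b k) (Y : Submodule ℂ E) (a : ℝ)
    (hY : ∀ y ∈ Y, (inner ℂ y (T y)).re ≤ a * ‖y‖ ^ 2) :
    Module.finrank ℂ Y ≤ Fintype.card {k // h k ≤ a} := by
  let f : Y →ₗ[ℂ] ({k // h k ≤ a} → ℂ) :=
    LinearMap.pi fun k => (innerₛₗ ℂ (b k)).comp Y.subtype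
  have hf : Function.Injective f := by
    rw [← LinearMap.ker_eq_bot, LinearMap.ker_eq_bot']
    rintro ⟨y, hy⟩ h0
    have hk : ∀ k, h k ≤ a → inner ℂ (b k) y = 0 := fun k hk => congrFun h0 ⟨k, hk⟩
    have h1 := hY y hy
    rw [b.inner_self_apply_of_diagonal hT, ← b.sum_sq_norm_inner_right, Finset.mul_sum,
      ← sub_nonpos, ← Finset.sum_sub_distrib] at h1
    have h2 : ∀ k ∈ Finset.univ,
        0 ≤ h k * ‖inner ℂ (b k) y‖ ^ 2 - a * ‖inner ℂ (b k) y‖ ^ 2 := by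
      intro k _
      by_cases hka : h k ≤ a
      · simp [hk k hka]
      · rw [← sub_mul]
        exact mul_nonneg (by linarith) (sq_nonneg _)
    have h3 := (Finset.sum_eq_zero_iff_of_nonneg h2).mp (le_antisymm h1 (Finset.sum_nonneg h2))
    have h4 : y = 0 := by
      rw [← b.sum_repr' y]
      refine Finset.sum_eq_zero fun k _ => ?_
      by_cases hka : h k ≤ a
      · simp [hk k hka]
      · have := h3 k (Finset.mem_univ k)
        rw [← sub_mul, mul_eq_zero, or_iff_right (by linarith)] at this
        rw [norm_eq_zero.mp (pow_eq_zero_iff two_ne_zero |>.mp this), zero_smul]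
    simpa using h4
  have := LinearMap.finrank_le_finrank_of_injective hf
  rwa [Module.finrank_fintype_fun_eq_card] at this

theorem finrank_le_card_ge (hT : ∀ k, T (b k) = (h k : ℂ) • b k) (Y : Submodule ℂ E) (a : ℝ)
    (hY : ∀ y ∈ Y, a * ‖y‖ ^ 2 ≤ (inner ℂ y (T y)).re) :
    Module.finrank ℂ Y ≤ Fintype.card {k // a ≤ h k} := by
  have := b.finrank_le_card_le (T := -T) (h := fun k => -h k) (by simp [hT]) Y (-a)
    (fun y hy => by simpa using hY y hy)
  simpa using this

/-- The other half of Courant–Fischer: a subspace found for one operator can be tested against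
another, which compares their eigenvalue counts. -/
theorem exists_finrank_eq_card_le (hT : ∀ k, T (b k) = (h k : ℂ) • b k) (a : ℝ) :
    ∃ Y : Submodule ℂ E, Module.finrank ℂ Y = Fintype.card {k // h k ≤ a} ∧
      ∀ y ∈ Y, (inner ℂ y (T y)).re ≤ a * ‖y‖ ^ 2 := by
  refine ⟨Submodule.span ℂ (Set.range fun k : {k // h k ≤ a} => b k), ?_, fun y hy => ?_⟩
  · exact finrank_span_eq_card
      (b.orthonormal.linearIndependent.comp _ Subtype.val_injective)
  · have h0 : ∀ k, ¬ h k ≤ a → inner ℂ (b k) y = 0 := by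
      intro k hk
      induction hy using Submodule.span_induction with
      | mem x hx =>
        obtain ⟨i, rfl⟩ := hx
        exact b.orthonormal.inner_eq_zero fun hki => hk (hki ▸ i.2)
      | zero => simp
      | add x y _ _ hx hy => rw [inner_add_right, hx, hy, add_zero]
      | smul c x _ hx => rw [inner_smul_right, hx, mul_zero]
    rw [b.inner_self_apply_of_diagonal hT, ← b.sum_sq_norm_inner_right, Finset.mul_sum]
    refine Finset.sum_le_sum fun k _ => ?_
    by_cases hk : h k ≤ a
    · exact mul_le_mul_of_nonneg_right hk (sq_nonneg _)
    · simp [h0 k hk]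

theorem exists_abs_le_of_norm_apply_le (hT : ∀ k, T (b k) = (h k : ℂ) • b k) {δ : ℝ}
    (hδ : 0 ≤ δ) {x : E} (hx : x ≠ 0) (hTx : ‖T x‖ ≤ δ * ‖x‖) : ∃ k, |h k| ≤ δ := by
  by_contra! hk
  have h1 : ‖T x‖ ^ 2 ≤ δ ^ 2 * ‖x‖ ^ 2 := by
    rw [← mul_pow]
    exact pow_le_pow_left₀ (norm_nonneg _) hTx 2
  rw [b.norm_apply_sq_of_diagonal hT, ← b.sum_sq_norm_inner_right, Finset.mul_sum] at h1
  have hs : ∀ k, δ ^ 2 < h k ^ 2 := fun k => by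
    rw [← sq_abs (h k)]
    exact pow_lt_pow_left₀ (hk k) hδ two_ne_zero
  have h2 : ∀ k ∈ Finset.univ,
      δ ^ 2 * ‖inner ℂ (b k) x‖ ^ 2 ≤ h k ^ 2 * ‖inner ℂ (b k) x‖ ^ 2 :=
    fun k _ => mul_le_mul_of_nonneg_right (hs k).le (sq_nonneg _)
  have h3 := (Finset.sum_eq_sum_iff_of_le h2).mp (le_antisymm (Finset.sum_le_sum h2) h1)
  apply hx
  rw [← b.sum_repr' x]
  refine Finset.sum_eq_zero fun k _ => ?_
  have h4 := h3 k (Finset.mem_univ k)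
  have h5 : ‖inner ℂ (b k) x‖ ^ 2 = 0 := by
    by_contra hne
    exact (hs k).ne (mul_right_cancel₀ hne h4)
  rw [norm_eq_zero.mp (pow_eq_zero_iff two_ne_zero |>.mp h5), zero_smul]

end OrthonormalBasis

/-! ### Monotone families of symmetric operators -/

section Monotone

variable {E : Type*} [NormedAddCommGroup E] [InnerProductSpace ℂ E] [FiniteDimensional ℂ E]

/-- The parameters at which a strictly decreasing family of symmetric operators has a small
eigenvalue form a set of small measure. -/
theorem volume_setOf_norm_apply_le {S : ℝ → E →ₗ[ℂ] E} {s : Set ℝ} {r δ : ℝ} (hr : 0 < r)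
    (hδ : 0 ≤ δ) (hS : ∀ t ∈ s, (S t).IsSymmetric)
    (hmono : ∀ t ∈ s, ∀ t' ∈ s, t < t' → ∀ x,
      (inner ℂ x (S t' x)).re ≤ (inner ℂ x (S t x)).re - r * (t' - t) * ‖x‖ ^ 2) :
    volume {t ∈ s | ∃ x, x ≠ 0 ∧ ‖S t x‖ ≤ δ * ‖x‖}
      ≤ Module.finrank ℂ E * ENNReal.ofReal (2 * δ / r) := by
  classical
  have hex : ∀ t, ∃ (b : OrthonormalBasis (Fin (Module.finrank ℂ E)) ℂ E)
      (h : Fin (Module.finrank ℂ E) → ℝ), t ∈ s → ∀ k, S t (b k) = (h k : ℂ) • b k := by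
    intro t
    by_cases ht : t ∈ s
    · exact ⟨(hS t ht).eigenvectorBasis rfl, (hS t ht).eigenvalues rfl,
        fun _ k => (hS t ht).apply_eigenvectorBasis rfl k⟩
    · exact ⟨stdOrthonormalBasis ℂ E, 0, fun h => absurd h ht⟩
  choose b h hb using hex
  let p : ℝ → ℕ := fun t => Fintype.card {k // h t k ≤ δ}
  let q : ℝ → ℕ := fun t => Fintype.card {k // h t k < -δ}
  -- On a subspace where the form of `S t` is at most `δ`, the form of `S t'` is at most `δ - r(t' -
  -- t) < -δ`. Every eigenvalue counted by `p t` has thus crossed the whole window `[-δ, δ]` by time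
  -- `t'`.
  have hpq : ∀ t ∈ s, ∀ t' ∈ s, 2 * δ / r < t' - t → p t ≤ q t' := by
    intro t ht t' ht' htt
    rw [div_lt_iff₀' hr] at htt
    have hlt : t < t' := by
      by_contra hle
      nlinarith
    obtain ⟨Y, hY, hYle⟩ := (b t).exists_finrank_eq_card_le (hb t ht) δ
    calc p t = Module.finrank ℂ Y := hY.symm
      _ ≤ Fintype.card {k // h t' k ≤ δ - r * (t' - t)} := by
        refine (b t').finrank_le_card_le (hb t' ht') Y _ fun y hy => ?_
        linarith [hmono t ht t' ht' hlt y, hYle y hy]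
      _ ≤ q t' := Fintype.card_subtype_mono _ _ fun k (hk : _ ≤ _) => by
        linarith
  -- In increasing order counted from `0`, the `k`-th eigenvalue lies in `[-δ, δ]` exactly when `q t
  -- ≤ k < p t`.
  let Z : Fin (Module.finrank ℂ E) → Set ℝ := fun k => {t ∈ s | q t ≤ k ∧ (k : ℕ) < p t}
  have hZ : ∀ k, volume (Z k) ≤ ENNReal.ofReal (2 * δ / r) := by
    intro k
    have key : ∀ t ∈ Z k, ∀ t' ∈ Z k, t' - t ≤ 2 * δ / r := by
      intro t ht t' ht'
      by_contra! hlt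
      have h1 := hpq t ht.1 t' ht'.1 hlt
      have h2 := ht.2.2
      have h3 := ht'.2.1
      omega
    -- The diameter bounds the outer measure, so measurability of `Z k` plays no role.
    refine (Real.volume_le_diam _).trans (Metric.ediam_le fun t ht t' ht' => ?_)
    rw [edist_dist, Real.dist_eq]
    refine ENNReal.ofReal_le_ofReal (abs_sub_le_iff.mpr ⟨key t' ht' t ht, key t ht t' ht'⟩)
  calc volume {t ∈ s | ∃ x, x ≠ 0 ∧ ‖S t x‖ ≤ δ * ‖x‖}
      ≤ volume (⋃ k, Z k) := by
        refine measure_mono fun t ht => ?_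
        obtain ⟨hts, x, hx, hle⟩ := ht
        obtain ⟨k, hk⟩ := (b t).exists_abs_le_of_norm_apply_le (hb t hts) hδ hx hle
        rw [abs_le] at hk
        have hlt : q t < p t := by
          refine Fintype.card_lt_of_injective_of_notMem
            (fun i : {k // h t k < -δ} => (⟨i.1, by linarith [i.2]⟩ : {k // h t k ≤ δ})) ?_
            (b := ⟨k, hk.2⟩) ?_
          · intro i j hij
            simpa [Subtype.ext_iff] using hij
          · rintro ⟨i, hi⟩
            simp only [Subtype.mk.injEq] at hi
            linarith [i.2, hi ▸ hk.1]
        have hp : p t ≤ Module.finrank ℂ E := by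
          simpa using Fintype.card_subtype_le fun k => h t k ≤ δ
        exact Set.mem_iUnion.mpr ⟨⟨q t, by omega⟩, hts, le_rfl, hlt⟩
    _ ≤ ∑ k, volume (Z k) := measure_iUnion_fintype_le _ _
    _ ≤ ∑ _k : Fin (Module.finrank ℂ E), ENNReal.ofReal (2 * δ / r) :=
        Finset.sum_le_sum fun k _ => hZ k
    _ = _ := by simp

end Monotone

end

noncomputable section

/-! ### Families that become monotone after a congruence -/

namespace OrthonormalBasis

variable {E : Type*} [NormedAddCommGroup E] [InnerProductSpace ℂ E] {ι : Type*} [Fintype ι]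
  (b : OrthonormalBasis ι ℂ E)

theorem ext_inner {x y : E} (h : ∀ k, inner ℂ (b k) x = inner ℂ (b k) y) : x = y := by
  rw [← b.sum_repr' x, ← b.sum_repr' y]
  simp only [h]

/-- The operator with eigenvectors `b k` and eigenvalues `h k`. -/
def diagonalOp (h : ι → ℝ) : E →ₗ[ℂ] E :=
  b.toBasis.constr ℂ fun k => (h k : ℂ) • b k

theorem diagonalOp_apply_basis (h : ι → ℝ) (k : ι) :
    b.diagonalOp h (b k) = (h k : ℂ) • b k := by
  rw [diagonalOp, ← b.coe_toBasis, Module.Basis.constr_basis]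

theorem inner_diagonalOp (h : ι → ℝ) (k : ι) (x : E) :
    inner ℂ (b k) (b.diagonalOp h x) = h k * inner ℂ (b k) x :=
  b.inner_apply_of_diagonal (b.diagonalOp_apply_basis h) k x

theorem inner_left_diagonalOp (h : ι → ℝ) (x : E) (k : ι) :
    inner ℂ (b.diagonalOp h x) (b k) = h k * inner ℂ x (b k) := by
  rw [← inner_conj_symm, inner_diagonalOp, map_mul, Complex.conj_ofReal, inner_conj_symm]

theorem diagonalOp_isSymmetric (h : ι → ℝ) : (b.diagonalOp h).IsSymmetric := by
  intro x y
  rw [← b.sum_inner_mul_inner, ← b.sum_inner_mul_inner]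
  refine Finset.sum_congr rfl fun k _ => ?_
  rw [inner_diagonalOp, inner_left_diagonalOp]
  ring

theorem diagonalOp_comp (h h' : ι → ℝ) (x : E) :
    b.diagonalOp h (b.diagonalOp h' x) = b.diagonalOp (fun k => h k * h' k) x := by
  refine b.ext_inner fun k => ?_
  simp only [inner_diagonalOp]
  push_cast
  ring

theorem diagonalOp_one (x : E) : b.diagonalOp (fun _ => 1) x = x := by
  refine b.ext_inner fun k => ?_
  simp [inner_diagonalOp]

theorem diagonalOp_sub (h h' : ι → ℝ) (x : E) :
    b.diagonalOp (fun k => h k - h' k) x = b.diagonalOp h x - b.diagonalOp h' x := by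
  refine b.ext_inner fun k => ?_
  rw [inner_sub_right]
  simp only [inner_diagonalOp]
  push_cast
  ring

theorem norm_diagonalOp_le {h : ι → ℝ} {C : ℝ} (hC : 0 ≤ C) (hh : ∀ k, |h k| ≤ C) (x : E) :
    ‖b.diagonalOp h x‖ ≤ C * ‖x‖ := by
  refine abs_le_of_sq_le_sq' ?_ (by positivity) |>.2
  rw [b.norm_apply_sq_of_diagonal (b.diagonalOp_apply_basis h), mul_pow,
    ← b.sum_sq_norm_inner_right, Finset.mul_sum]
  refine Finset.sum_le_sum fun k _ => mul_le_mul_of_nonneg_right ?_ (sq_nonneg _)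
  rw [← sq_abs]
  exact pow_le_pow_left₀ (abs_nonneg _) (hh k) 2

end OrthonormalBasis

namespace QPWave

/-- The weight that makes the diagonal entry `h - t² y` monotone in `t`. -/
def weight (h t : ℝ) : ℝ := if 0 < h then t⁻¹ else t

theorem Lam_pos {t : ℝ} (ht : t ∈ Lam) : 0 < t := lt_of_lt_of_le (by norm_num) ht.1

theorem weight_pos (h : ℝ) {t : ℝ} (ht : t ∈ Lam) : 0 < weight h t := by
  unfold weight
  have := Lam_pos ht
  split_ifs <;> positivity

theorem inv_le_two {t : ℝ} (ht : t ∈ Lam) : t⁻¹ ≤ 2 := by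
  have := inv_anti₀ (by norm_num : (0 : ℝ) < 1 / 2) ht.1
  norm_num at this
  exact this

theorem abs_weight_le (h : ℝ) {t : ℝ} (ht : t ∈ Lam) : |weight h t| ≤ 2 := by
  rw [abs_of_pos (weight_pos h ht)]
  unfold weight
  split_ifs
  · exact inv_le_two ht
  · linarith [ht.2]

theorem abs_weight_sub_le (h : ℝ) {t t' : ℝ} (ht : t ∈ Lam) (ht' : t' ∈ Lam) (hle : t ≤ t') :
    |weight h t' - weight h t| ≤ 4 * (t' - t) := by
  have h0 := Lam_pos ht
  have h0' := Lam_pos ht'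
  unfold weight
  split_ifs
  · rw [abs_sub_comm, inv_sub_inv h0.ne' h0'.ne', abs_of_nonneg (by
      apply div_nonneg <;> nlinarith), div_le_iff₀ (by positivity)]
    have : 1 ≤ 4 * (t * t') := by nlinarith [ht.1, ht'.1]
    nlinarith
  · rw [abs_of_nonneg (by linarith)]
    linarith

/-- The weighted entry is `-y + h t⁻²` for `h > 0` and `-t⁴y + h t²` for `h < 0`: the part with `y`
never increases and the part with `h` strictly decreases. The constant `1/6` is not sharp; it serves
both signs on `[1/2, 3/2]`. -/
theorem weighted_diagonal_le {β y h : ℝ} (hβ : 0 < β) (hy : 0 ≤ y) (hh : β ≤ |h|) {t t' : ℝ}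
    (ht : t ∈ Lam) (ht' : t' ∈ Lam) (hle : t ≤ t') :
    (-(t' ^ 2 * y) + h) * weight h t' ^ 2
      ≤ (-(t ^ 2 * y) + h) * weight h t ^ 2 - β / 6 * (t' - t) := by
  have h0 := Lam_pos ht
  have h0' := Lam_pos ht'
  unfold weight
  split_ifs with hpos
  · rw [abs_of_pos hpos] at hh
    have e : ∀ s : ℝ, 0 < s → (-(s ^ 2 * y) + h) * s⁻¹ ^ 2 = -y + h * s⁻¹ ^ 2 := by
      intro s hs
      field_simp
    rw [e t h0, e t' h0']
    have hi : 2 / 3 ≤ t⁻¹ := by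
      rw [le_inv_comm₀ (by norm_num) h0]
      norm_num
      exact ht.2
    have hi' : 2 / 3 ≤ t'⁻¹ := by
      rw [le_inv_comm₀ (by norm_num) h0']
      norm_num
      exact ht'.2
    have hd : t⁻¹ - t'⁻¹ = (t' - t) * (t⁻¹ * t'⁻¹) := by
      field_simp
    have h1 : 4 / 9 ≤ t⁻¹ * t'⁻¹ := by nlinarith
    have h2 : 4 / 9 * (t' - t) ≤ t⁻¹ - t'⁻¹ := by
      rw [hd]
      nlinarith
    have h3 : 1 / 6 * (t' - t) ≤ t⁻¹ ^ 2 - t'⁻¹ ^ 2 := by nlinarith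
    have h4 : β * (1 / 6 * (t' - t)) ≤ h * (t⁻¹ ^ 2 - t'⁻¹ ^ 2) :=
      mul_le_mul hh h3 (by nlinarith) hpos.le
    linarith
  · rw [abs_of_nonpos (not_lt.mp hpos)] at hh
    have h1 : t ^ 2 ≤ t' ^ 2 := pow_le_pow_left₀ h0.le hle 2
    have h2 : t ^ 4 ≤ t' ^ 4 := pow_le_pow_left₀ h0.le hle 4
    have h3 : 1 / 6 * (t' - t) ≤ t' ^ 2 - t ^ 2 := by nlinarith [ht.1, ht'.1]
    have h4 : β * (1 / 6 * (t' - t)) ≤ (-h) * (t' ^ 2 - t ^ 2) :=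
      mul_le_mul hh h3 (by nlinarith) (by linarith)
    have h5 : 0 ≤ y * (t' ^ 4 - t ^ 4) := mul_nonneg hy (by linarith)
    nlinarith

variable {E : Type*} [NormedAddCommGroup E] [InnerProductSpace ℂ E] {ι : Type*} [Fintype ι]

/-- Polarisation, with the cross terms cancelling by symmetry. It makes the change of a quadratic
form linear in the size of `w - v`. -/
theorem re_inner_self_sub_re_inner_self {T : E →ₗ[ℂ] E} (hT : T.IsSymmetric) (v w : E) :
    (inner ℂ w (T w)).re - (inner ℂ v (T v)).re = (inner ℂ (w + v) (T (w - v))).re := by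
  have h1 : (inner ℂ v (T w)).re = (inner ℂ w (T v)).re := by
    rw [← hT v w, ← inner_conj_symm, Complex.conj_re]
  simp only [map_sub, inner_add_left, inner_sub_right, Complex.add_re, Complex.sub_re, h1]
  ring

/-- A family `h - t² y - T(t)`, with `h` bounded away from zero and `T` small and Lipschitz, is
nearly singular only for few values of `t`. -/
theorem volume_setOf_norm_perturbed_apply_le (b : OrthonormalBasis ι ℂ E) {y h : ι → ℝ} {β c δ : ℝ}
    (hβ : 0 < β) (hδ : 0 ≤ δ) (hy : ∀ i, 0 ≤ y i) (hh : ∀ i, β ≤ |h i|) (hc : 240 * c ≤ β)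
    (hc0 : 0 ≤ c) {T : ℝ → E →ₗ[ℂ] E} (hT : ∀ t ∈ Lam, (T t).IsSymmetric)
    (hTc : ∀ t ∈ Lam, ∀ x, ‖T t x‖ ≤ c * ‖x‖)
    (hTL : ∀ t ∈ Lam, ∀ t' ∈ Lam, ∀ x,
      |(inner ℂ x (T t' x)).re - (inner ℂ x (T t x)).re| ≤ c * |t' - t| * ‖x‖ ^ 2)
    {A : ℝ → E →ₗ[ℂ] E}
    (hA : ∀ t ∈ Lam, ∀ x, A t x = b.diagonalOp (fun i => -(t ^ 2 * y i) + h i) x - T t x) :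
    volume {t ∈ Lam | ∃ x, x ≠ 0 ∧ ‖A t x‖ ≤ δ * ‖x‖}
      ≤ Fintype.card ι * ENNReal.ofReal (96 * δ / β) := by
  have : FiniteDimensional ℂ E := b.toBasis.finiteDimensional_of_finite
  let W : ℝ → E →ₗ[ℂ] E := fun t => b.diagonalOp fun i => weight (h i) t
  let S : ℝ → E →ₗ[ℂ] E := fun t => W t ∘ₗ A t ∘ₗ W t
  have hWsymm : ∀ t, (W t).IsSymmetric := fun t => b.diagonalOp_isSymmetric _
  have hWnorm : ∀ t ∈ Lam, ∀ x, ‖W t x‖ ≤ 2 * ‖x‖ := fun t ht =>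
    b.norm_diagonalOp_le zero_le_two fun k => abs_weight_le _ ht
  have hAsymm : ∀ t ∈ Lam, (A t).IsSymmetric := by
    intro t ht x z
    rw [hA t ht, hA t ht, inner_sub_left, inner_sub_right, b.diagonalOp_isSymmetric, hT t ht]
  have hSsymm : ∀ t ∈ Lam, (S t).IsSymmetric := by
    intro t ht x z
    simp only [S, LinearMap.comp_apply]
    rw [hWsymm, hAsymm t ht, hWsymm]
  have hform : ∀ t ∈ Lam, ∀ x, (inner ℂ x (S t x)).re
      = ∑ i, (-(t ^ 2 * y i) + h i) * weight (h i) t ^ 2 * ‖inner ℂ (b i) x‖ ^ 2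
        - (inner ℂ (W t x) (T t (W t x))).re := by
    intro t ht x
    simp only [S, LinearMap.comp_apply]
    rw [← hWsymm, hA t ht, inner_sub_right, Complex.sub_re,
      b.inner_self_apply_of_diagonal (b.diagonalOp_apply_basis _)]
    congr 1
    refine Finset.sum_congr rfl fun i _ => ?_
    rw [b.inner_diagonalOp, norm_mul, mul_pow, Complex.norm_real, Real.norm_eq_abs, sq_abs]
    ring
  -- Rate budget: the diagonal gives `β/6`; the variation of `T` costs `4c` (as `‖W‖ ≤ 2`) and that
  -- of `W` costs `16c` (as `W` is `4`-Lipschitz). Since `20c ≤ β/12`, half of the rate survives.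
  have hmono : ∀ t ∈ Lam, ∀ t' ∈ Lam, t < t' → ∀ x,
      (inner ℂ x (S t' x)).re ≤ (inner ℂ x (S t x)).re - β / 12 * (t' - t) * ‖x‖ ^ 2 := by
    intro t ht t' ht' hlt x
    have hd : 0 ≤ t' - t := by linarith
    rw [hform t ht, hform t' ht']
    have h1 : ∑ i, (-(t' ^ 2 * y i) + h i) * weight (h i) t' ^ 2 * ‖inner ℂ (b i) x‖ ^ 2
        ≤ ∑ i, (-(t ^ 2 * y i) + h i) * weight (h i) t ^ 2 * ‖inner ℂ (b i) x‖ ^ 2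
          - β / 6 * (t' - t) * ‖x‖ ^ 2 := by
      rw [← b.sum_sq_norm_inner_right, Finset.mul_sum, ← Finset.sum_sub_distrib]
      refine Finset.sum_le_sum fun i _ => ?_
      rw [← sub_mul]
      exact mul_le_mul_of_nonneg_right
        (weighted_diagonal_le hβ (hy i) (hh i) ht ht' hlt.le) (sq_nonneg _)
    have h2 : (inner ℂ (W t' x) (T t (W t' x))).re - (inner ℂ (W t' x) (T t' (W t' x))).re
        ≤ c * (t' - t) * (4 * ‖x‖ ^ 2) := by
      have h3 := (neg_le_abs _).trans (hTL t ht t' ht' (W t' x))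
      rw [abs_of_nonneg hd] at h3
      have h4 : ‖W t' x‖ ^ 2 ≤ 4 * ‖x‖ ^ 2 := by
        nlinarith [pow_le_pow_left₀ (norm_nonneg _) (hWnorm t' ht' x) 2]
      have h5 := mul_le_mul_of_nonneg_left h4 (mul_nonneg hc0 hd)
      linarith
    have h6 : (inner ℂ (W t x) (T t (W t x))).re - (inner ℂ (W t' x) (T t (W t' x))).re
        ≤ c * (t' - t) * (16 * ‖x‖ ^ 2) := by
      rw [re_inner_self_sub_re_inner_self (hT t ht)]
      have h7 : ‖W t x - W t' x‖ ≤ 4 * (t' - t) * ‖x‖ := by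
        rw [norm_sub_rev, ← b.diagonalOp_sub]
        exact b.norm_diagonalOp_le (by positivity)
          (fun k => abs_weight_sub_le _ ht ht' hlt.le) x
      have h8 : ‖W t x + W t' x‖ ≤ 4 * ‖x‖ :=
        (norm_add_le _ _).trans (by linarith [hWnorm t ht x, hWnorm t' ht' x])
      calc _ ≤ ‖W t x + W t' x‖ * ‖T t (W t x - W t' x)‖ := re_inner_le_norm (𝕜 := ℂ) _ _
        _ ≤ (4 * ‖x‖) * (c * (4 * (t' - t) * ‖x‖)) := by
          refine mul_le_mul h8 ((hTc t ht _).trans ?_) (norm_nonneg _) (by positivity)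
          exact mul_le_mul_of_nonneg_left h7 hc0
        _ = _ := by ring
    have h9 : 20 * c * ((t' - t) * ‖x‖ ^ 2) ≤ β / 12 * ((t' - t) * ‖x‖ ^ 2) :=
      mul_le_mul_of_nonneg_right (by linarith) (by positivity)
    linarith
  -- The congruence uses `W` twice, each time with norm at most `2`, so the threshold `δ` for `A`
  -- becomes `4δ` for `S`.
  have hvol := volume_setOf_norm_apply_le (S := S) (s := Lam) (r := β / 12) (δ := 4 * δ)
    (by positivity) (by positivity) hSsymm hmono
  rw [Module.finrank_eq_card_basis b.toBasis, show 2 * (4 * δ) / (β / 12) = 96 * δ / β by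
    field_simp; ring] at hvol
  refine (measure_mono ?_).trans hvol
  rintro t ⟨ht, x, hx, hle⟩
  have hinv : W t (b.diagonalOp (fun i => (weight (h i) t)⁻¹) x) = x := by
    simp only [W]
    rw [b.diagonalOp_comp]
    simp only [mul_inv_cancel₀ (weight_pos _ ht).ne']
    exact b.diagonalOp_one x
  set z := b.diagonalOp (fun i => (weight (h i) t)⁻¹) x with hz
  refine ⟨ht, z, fun h0 => hx (by rw [← hinv, h0, map_zero]), ?_⟩
  calc ‖S t z‖ = ‖W t (A t x)‖ := by simp only [S, LinearMap.comp_apply, hinv]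
    _ ≤ 2 * ‖A t x‖ := hWnorm t ht _
    _ ≤ 2 * (δ * (2 * ‖z‖)) := by
      have := hWnorm t ht z
      rw [hinv] at this
      have := mul_le_mul_of_nonneg_left this hδ
      linarith
    _ = 4 * δ * ‖z‖ := by ring

end QPWave

end

noncomputable section

/-! ### Diagonal operators on a Hilbert space -/

namespace HilbertBasis

variable {E : Type*} [NormedAddCommGroup E] [InnerProductSpace ℂ E] {J : Type*}
  (b : HilbertBasis J ℂ E)

theorem ext_inner {x y : E} (h : ∀ j, inner ℂ (b j) x = inner ℂ (b j) y) : x = y := by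
  apply b.repr.injective
  ext j
  simpa [b.repr_apply_apply] using h j

theorem hasSum_sq_norm_inner (x : E) : HasSum (fun j => ‖inner ℂ (b j) x‖ ^ 2) (‖x‖ ^ 2) := by
  have h := Complex.hasSum_re (b.hasSum_inner_mul_inner x x)
  have h1 : (inner ℂ x x : ℂ).re = ‖x‖ ^ 2 := inner_self_eq_norm_sq (𝕜 := ℂ) x
  rw [h1] at h
  refine h.congr_fun fun j => ?_
  rw [← inner_conj_symm x (b j), ← Complex.normSq_eq_conj_mul_self, Complex.ofReal_re,
    Complex.normSq_eq_norm_sq]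

theorem exists_inner_eq {a : J → ℂ} (ha : Summable fun j => ‖a j‖ ^ 2) :
    ∃ x : E, ∀ j, inner ℂ (b j) x = a j := by
  have hmem : Memℓp a 2 := memℓp_gen (by simpa using ha)
  refine ⟨b.repr.symm ⟨a, hmem⟩, fun j => ?_⟩
  rw [← b.repr_apply_apply, LinearIsometryEquiv.apply_symm_apply]

theorem norm_le_of_diagonal {g : J → ℝ} {C : ℝ} (hC : 0 ≤ C) (hg : ∀ j, |g j| ≤ C)
    {x y : E} (h : ∀ j, inner ℂ (b j) y = g j * inner ℂ (b j) x) : ‖y‖ ≤ C * ‖x‖ := by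
  refine abs_le_of_sq_le_sq' ?_ (by positivity) |>.2
  rw [mul_pow]
  refine hasSum_le (fun j => ?_) (b.hasSum_sq_norm_inner y)
    ((b.hasSum_sq_norm_inner x).mul_left (C ^ 2))
  rw [h, norm_mul, mul_pow, Complex.norm_real, Real.norm_eq_abs]
  gcongr
  exact hg j

theorem exists_diagonal {g : J → ℝ} {C : ℝ} (hC : 0 ≤ C) (hg : ∀ j, |g j| ≤ C) :
    ∃ G : E →L[ℂ] E, ‖G‖ ≤ C ∧ ∀ j x, inner ℂ (b j) (G x) = g j * inner ℂ (b j) x := by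
  have hex : ∀ x : E, ∃ y : E, ∀ j, inner ℂ (b j) y = g j * inner ℂ (b j) x := by
    intro x
    refine b.exists_inner_eq (.of_nonneg_of_le (fun j => sq_nonneg _) (fun j => ?_)
      ((b.hasSum_sq_norm_inner x).summable.mul_left (C ^ 2)))
    rw [norm_mul, mul_pow, Complex.norm_real, Real.norm_eq_abs]
    gcongr
    exact hg j
  choose G hG using hex
  let G' : E →ₗ[ℂ] E :=
    { toFun := G
      map_add' := fun x y => b.ext_inner fun j => by
        simp only [hG, inner_add_right, mul_add]
      map_smul' := fun c x => b.ext_inner fun j => by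
        simp only [hG, inner_smul_right, RingHom.id_apply]
        ring }
  have hbd : ∀ x, ‖G' x‖ ≤ C * ‖x‖ := fun x => b.norm_le_of_diagonal hC hg fun j => hG x j
  exact ⟨G'.mkContinuous C hbd, G'.mkContinuous_norm_le hC hbd, fun j x => hG x j⟩

/-- Keeping only the finitely many entries with `|g j| ≥ r/2` gives a finite-rank operator at
distance less than `r`, and compact operators are closed in norm. -/
theorem isCompactOperator_of_diagonal [CompleteSpace E] {g : J → ℝ}
    (hg : Filter.Tendsto g Filter.cofinite (nhds 0)) {G : E →L[ℂ] E}
    (hG : ∀ j x, inner ℂ (b j) (G x) = g j * inner ℂ (b j) x) : IsCompactOperator G := by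
  classical
  have hcl : IsClosed {f : E →L[ℂ] E | IsCompactOperator f} := isClosed_setOfPred_isCompactOperator
  suffices hG' : G ∈ closure {f : E →L[ℂ] E | IsCompactOperator f} by
    rwa [hcl.closure_eq] at hG'
  refine Metric.mem_closure_iff.mpr fun r hr => ?_
  have hfin : {j | ¬ |g j| < r / 2}.Finite := by
    have := hg.eventually (Metric.ball_mem_nhds 0 (half_pos hr))
    simpa [Filter.eventually_cofinite] using this
  let F : E →L[ℂ] E := ∑ j ∈ hfin.toFinset,
    (g j : ℂ) • (ContinuousLinearMap.toSpanSingleton ℂ (b j)).comp (innerSL ℂ (b j))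
  have hF : ∀ j x, inner ℂ (b j) (F x) = if |g j| < r / 2 then 0 else g j * inner ℂ (b j) x := by
    intro j x
    simp only [F, sum_apply, inner_sum, smul_apply,
      ContinuousLinearMap.comp_apply, ContinuousLinearMap.toSpanSingleton_apply, innerSL_apply_apply,
      inner_smul_right, orthonormal_iff_ite.mp b.orthonormal, mul_ite, mul_one, mul_zero,
      Finset.sum_ite_eq, Set.Finite.mem_toFinset, Set.mem_ofPred_eq]
    split_ifs <;> tauto
  refine ⟨F, ?_, ?_⟩
  · have : F ∈ compactOperator (RingHom.id ℂ) E E := by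
      refine Submodule.sum_mem _ fun j _ => Submodule.smul_mem _ _ ?_
      exact IsCompactOperator.comp_clm
        (f := ContinuousLinearMap.toSpanSingleton ℂ (b j))
        (isCompactOperator_of_locallyCompactSpace_rng
          (ContinuousLinearMap.toSpanSingleton ℂ (b j))) (innerSL ℂ (b j))
    exact this
  · rw [dist_eq_norm]
    refine lt_of_le_of_lt (ContinuousLinearMap.opNorm_le_bound _ (half_pos hr).le fun x => ?_)
      (half_lt_self hr)
    refine b.norm_le_of_diagonal (g := fun j => if |g j| < r / 2 then g j else 0)
      (half_pos hr).le (fun j => ?_) fun j => ?_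
    · split_ifs with h
      · exact h.le
      · simpa using (half_pos hr).le
    · rw [sub_apply, inner_sub_right, hF, hG]
      split_ifs <;> simp

end HilbertBasis

/-- A dense orthogonal family of closed subspaces has an adapted Hilbert basis. -/
theorem OrthogonalFamily.exists_hilbertBasis.{u, v} {E : Type u} [NormedAddCommGroup E]
    [InnerProductSpace ℂ E] [CompleteSpace E] {ι : Type v} {V : ι → Submodule ℂ E}
    (hV : OrthogonalFamily ℂ (fun i => V i) fun i => (V i).subtypeₗᵢ)
    (hclosed : ∀ i, IsClosed (V i : Set E)) (hbot : (⨆ i, V i)ᗮ = ⊥) :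
    ∃ (ι' : Type (max u v)) (w : HilbertBasis ι' ℂ E), ∀ n, ∃ i, w n ∈ V i := by
  have hcomplete : ∀ i, CompleteSpace (V i) := fun i => (hclosed i).completeSpace_coe
  choose s hb _ using fun i => _root_.exists_hilbertBasis ℂ (V i)
  let v : (Σ i, s i) → E := fun p => (hb p.1 p.2 : V p.1)
  have hv : Orthonormal ℂ v := hV.orthonormal_sigma_orthonormal fun i => (hb i).orthonormal
  have hvbot : (Submodule.span ℂ (Set.range v))ᗮ = ⊥ := by
    rw [eq_bot_iff, ← hbot]
    intro x hx
    rw [Submodule.mem_orthogonal'] at hx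
    have hxv : ∀ i, ∀ y ∈ V i, inner ℂ x y = 0 := by
      intro i y hy
      have h1 := ((innerSL ℂ x).comp (V i).subtypeL).hasSum ((hb i).hasSum_repr ⟨y, hy⟩)
      refine h1.unique ?_
      have h2 : ∀ n, ((innerSL ℂ x).comp (V i).subtypeL)
          ((hb i).repr ⟨y, hy⟩ n • hb i n) = 0 := by
        intro n
        rw [map_smul]
        have h3 : inner ℂ x (v ⟨i, n⟩) = 0 := hx _ (Submodule.subset_span ⟨_, rfl⟩)
        have h4 : ((innerSL ℂ x).comp (V i).subtypeL) (hb i n) = inner ℂ x (v ⟨i, n⟩) := rfl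
        rw [h4, h3, smul_zero]
      simp only [h2]
      exact hasSum_zero
    rw [Submodule.mem_orthogonal']
    intro y hy
    induction hy using Submodule.iSup_induction' with
    | mem κ y hy => exact hxv κ y hy
    | zero => simp
    | add y z _ _ hy hz => rw [inner_add_right, hy, hz, add_zero]
  refine ⟨_, HilbertBasis.mkOfOrthogonalEqBot hv hvbot, fun p => ⟨p.1, ?_⟩⟩
  rw [HilbertBasis.coe_mkOfOrthogonalEqBot]
  exact (hb p.1 p.2).2

/-- A compact symmetric operator has a Hilbert basis of eigenvectors. -/
theorem IsCompactOperator.exists_hilbertBasis_eigenvectors.{u} {E : Type u} [NormedAddCommGroup E]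
    [InnerProductSpace ℂ E] [CompleteSpace E] {K : E →L[ℂ] E} (hK : IsCompactOperator K)
    (hsymm : (K : E →ₗ[ℂ] E).IsSymmetric) :
    ∃ (ι : Type u) (w : HilbertBasis ι ℂ E) (κ : ι → ℂ), ∀ n, K (w n) = κ n • w n := by
  have hmem : ∀ κ x, x ∈ Module.End.eigenspace (K : E →ₗ[ℂ] E) κ ↔ K x = κ • x :=
    fun κ x => Module.End.mem_eigenspace_iff
  obtain ⟨ι, w, hw⟩ := hsymm.orthogonalFamily_eigenspaces.exists_hilbertBasis
    (fun κ => by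
      have h : (Module.End.eigenspace (K : E →ₗ[ℂ] E) κ : Set E) = {x | K x = κ • x} :=
        Set.ext fun x => hmem κ x
      rw [h]
      exact isClosed_eq K.continuous (continuous_const_smul κ))
    (ContinuousLinearMap.orthogonalComplement_iSup_eigenspaces_eq_bot hK hsymm)
  choose κ hκ using hw
  exact ⟨ι, w, κ, fun n => (hmem _ _).mp (hκ n)⟩

end

noncomputable section

/-! ### Diagonal operators with bounded perturbations -/

namespace QPWave

universe u

variable {E : Type u} [NormedAddCommGroup E] [InnerProductSpace ℂ E] {J : Type*}

/-- `f = (D + V) u`, where `D` is diagonal in the basis `b` with entries `e`. -/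
def IsImage (b : HilbertBasis J ℂ E) (e : J → ℝ) (V : E →L[ℂ] E) (u f : E) : Prop :=
  ∀ j, inner ℂ (b j) f = e j * inner ℂ (b j) u + inner ℂ (b j) (V u)

namespace IsImage

variable {b : HilbertBasis J ℂ E} {e : J → ℝ} {V : E →L[ℂ] E} {u f u' f' : E}

theorem zero : IsImage b e V 0 0 := fun j => by simp

theorem add (h : IsImage b e V u f) (h' : IsImage b e V u' f') :
    IsImage b e V (u + u') (f + f') := fun j => by
  simp only [inner_add_right, map_add, h j, h' j]
  ring

theorem smul (c : ℂ) (h : IsImage b e V u f) : IsImage b e V (c • u) (c • f) := fun j => by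
  simp only [inner_smul_right, map_smul, h j]
  ring

theorem hasSum_inner (h : IsImage b e V u f) (v : E) :
    HasSum (fun j => e j * (inner ℂ v (b j) * inner ℂ (b j) u))
      (inner ℂ v f - inner ℂ v (V u)) := by
  refine ((b.hasSum_inner_mul_inner v f).sub (b.hasSum_inner_mul_inner v (V u))).congr_fun
    fun j => ?_
  rw [h j]
  ring

/-- Symmetry of `D + V` on its maximal domain. Up to the contribution of the bounded `V`, both sides
are the sum of the same convergent series of terms `e j * (inner ℂ u (b j) * inner ℂ (b j) u')`. -/
theorem inner_comm (hV : (V : E →ₗ[ℂ] E).IsSymmetric) (h : IsImage b e V u f)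
    (h' : IsImage b e V u' f') : inner ℂ u f' = inner ℂ f u' := by
  have h1 := h'.hasSum_inner u
  have h2 : HasSum (fun j => e j * (inner ℂ u (b j) * inner ℂ (b j) u'))
      (inner ℂ f u' - inner ℂ (V u) u') := by
    have := Complex.hasSum_conj'.mpr (h.hasSum_inner u')
    simp only [map_sub, map_mul, inner_conj_symm, Complex.conj_ofReal] at this
    refine this.congr_fun fun j => ?_
    ring
  have h3 := h1.unique h2
  have h4 : inner ℂ (V u) u' = inner ℂ u (V u') := hV u u'
  rw [h4] at h3
  exact sub_left_injective h3

theorem hasSum_energy (h : IsImage b e V u f) :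
    HasSum (fun j => e j * ‖inner ℂ (b j) u‖ ^ 2) ((inner ℂ u f).re - (inner ℂ u (V u)).re) := by
  have := Complex.hasSum_re (h.hasSum_inner u)
  rw [Complex.sub_re] at this
  refine this.congr_fun fun j => ?_
  rw [Complex.re_ofReal_mul, ← inner_conj_symm u (b j), ← Complex.normSq_eq_conj_mul_self,
    Complex.ofReal_re, Complex.normSq_eq_norm_sq]

end IsImage

theorem abs_re_inner_apply_le (V : E →L[ℂ] E) (x y : E) :
    |(inner ℂ x (V y)).re| ≤ ‖V‖ * (‖x‖ * ‖y‖) :=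
  calc _ ≤ ‖inner ℂ x (V y)‖ := Complex.abs_re_le_norm _
    _ ≤ ‖x‖ * ‖V y‖ := norm_inner_le_norm _ _
    _ ≤ ‖x‖ * (‖V‖ * ‖y‖) := mul_le_mul_of_nonneg_left (V.le_opNorm y) (norm_nonneg _)
    _ = _ := by ring

variable (b : HilbertBasis J ℂ E) {e : J → ℝ} {V : E →L[ℂ] E}

/-- The resolvent of `D + V` at a large negative parameter. -/
theorem exists_resolvent [CompleteSpace E] (he : ∀ j, 0 ≤ e j) (he' : Filter.Tendsto e Filter.cofinite Filter.atTop)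
    (V : E →L[ℂ] E) :
    ∃ K : E →L[ℂ] E, IsCompactOperator K ∧
      ∀ u f, K f = u ↔ IsImage b e V u (f - ((‖V‖ + 1 : ℝ) : ℂ) • u) := by
  set s : ℝ := ‖V‖ + 1 with hs
  have hs0 : 0 < s := by positivity
  have hes : ∀ j, 0 < e j + s := fun j => by linarith [he j]
  obtain ⟨G, hGn, hG⟩ := b.exists_diagonal (g := fun j => (e j + s)⁻¹) (C := s⁻¹)
    (by positivity) (fun j => by
      rw [abs_of_pos (inv_pos.mpr (hes j))]
      exact inv_anti₀ hs0 (by linarith [he j]))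
  have hGc : IsCompactOperator G := by
    refine b.isCompactOperator_of_diagonal (Filter.Tendsto.comp tendsto_inv_atTop_zero ?_) hG
    exact Filter.tendsto_atTop_add_const_right _ _ he'
  -- With `G = (D + s)⁻¹` and `s = ‖V‖ + 1`, the factor `1 + GV` is inverted by a Neumann series, so
  -- that `(D + V + s)⁻¹ = (1 + GV)⁻¹ G` is compact along with `G`.
  have hlt : ‖-(G * V)‖ < 1 := by
    rw [norm_neg]
    calc ‖G * V‖ ≤ ‖G‖ * ‖V‖ := norm_mul_le _ _
      _ ≤ s⁻¹ * ‖V‖ := mul_le_mul_of_nonneg_right hGn (norm_nonneg _)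
      _ < 1 := by
        rw [inv_mul_lt_iff₀ hs0]
        linarith
  let U : (E →L[ℂ] E)ˣ := Units.oneSub (-(G * V)) hlt
  have hU : ∀ x, (U : E →L[ℂ] E) x = x + G (V x) := by
    intro x
    simp [U]
  refine ⟨(↑U⁻¹ : E →L[ℂ] E) * G, hGc.clm_comp (↑U⁻¹ : E →L[ℂ] E), fun u f => ?_⟩
  have h1 : ((↑U⁻¹ : E →L[ℂ] E) * G) f = u ↔ G f = (U : E →L[ℂ] E) u := by
    constructor
    · rintro rfl
      rw [← mul_apply_eq_comp, Units.mul_inv_cancel_left]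
    · intro h
      rw [mul_apply_eq_comp, h, ← mul_apply_eq_comp, Units.inv_mul]
      rfl
  rw [h1, hU]
  have h2 : ∀ j, inner ℂ (b j) (G f) = inner ℂ (b j) (u + G (V u)) ↔
      inner ℂ (b j) (f - (s : ℂ) • u) = e j * inner ℂ (b j) u + inner ℂ (b j) (V u) := by
    intro j
    have hne : ((e j : ℂ) + s) ≠ 0 := by
      exact_mod_cast (hes j).ne'
    rw [inner_add_right, hG, hG, inner_sub_right, inner_smul_right]
    push_cast
    rw [← sub_eq_iff_eq_add, ← mul_sub, inv_mul_eq_iff_eq_mul₀ hne, sub_eq_iff_eq_add,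
      sub_eq_iff_eq_add]
    constructor <;> intro h <;> rw [h] <;> ring
  constructor
  · intro h j
    exact (h2 j).mp (by rw [h])
  · intro h
    exact b.ext_inner fun j => (h2 j).mpr (h j)

/-- The resolvent `K` is compact, symmetric and injective, so it has a Hilbert basis of eigenvectors
with nonzero real eigenvalues `κ`. The same vectors are eigenvectors of `D + V`, with eigenvalues
`κ⁻¹ - s`. -/
theorem exists_eigenbasis [CompleteSpace E] (he : ∀ j, 0 ≤ e j)
    (he' : Filter.Tendsto e Filter.cofinite Filter.atTop) (hV : (V : E →ₗ[ℂ] E).IsSymmetric) :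
    ∃ (ι : Type u) (w : HilbertBasis ι ℂ E) (μ : ι → ℝ),
      ∀ n, IsImage b e V (w n) ((μ n : ℂ) • w n) := by
  obtain ⟨K, hKc, hK⟩ := exists_resolvent b he he' V
  set s : ℝ := ‖V‖ + 1
  have hKimage : ∀ f, IsImage b e V (K f) (f - (s : ℂ) • K f) := fun f => (hK _ f).mp rfl
  have hKsymm : (K : E →ₗ[ℂ] E).IsSymmetric := by
    intro f f'
    have h := (hKimage f).inner_comm hV (hKimage f')
    rw [inner_sub_right, inner_sub_left, inner_smul_left, inner_smul_right, Complex.conj_ofReal]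
      at h
    exact sub_left_injective h
  obtain ⟨ι, w, κ, hκ⟩ := hKc.exists_hilbertBasis_eigenvectors hKsymm
  have hwne : ∀ n, w n ≠ 0 := fun n => w.orthonormal.ne_zero n
  have hκ0 : ∀ n, κ n ≠ 0 := by
    intro n h0
    have h1 : K (w n) = 0 := by rw [hκ, h0, zero_smul]
    have h2 := (hK 0 (w n)).mp h1
    apply hwne n
    refine b.ext_inner fun j => ?_
    simpa using h2 j
  have hκre : ∀ n, ((κ n).re : ℂ) = κ n := by
    intro n
    have hev : Module.End.HasEigenvalue (K : E →ₗ[ℂ] E) (κ n) :=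
      Module.End.hasEigenvalue_of_hasEigenvector
        ⟨Module.End.mem_eigenspace_iff.mpr (hκ n), hwne n⟩
    exact Complex.conj_eq_iff_re.mp (hKsymm.conj_eigenvalue_eq_self hev)
  refine ⟨ι, w, fun n => (κ n).re⁻¹ - s, fun n => ?_⟩
  have h := (hKimage (w n)).smul (κ n)⁻¹
  rw [hκ, smul_sub, smul_comm (κ n)⁻¹ (s : ℂ), inv_smul_smul₀ (hκ0 n)] at h
  push_cast
  rwa [hκre, sub_smul]

section Eigenbasis

variable {b} {ι : Type u} (w : HilbertBasis ι ℂ E) {μ : ι → ℝ} {u f : E}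

theorem inner_image (hV : (V : E →ₗ[ℂ] E).IsSymmetric)
    (hw : ∀ n, IsImage b e V (w n) ((μ n : ℂ) • w n)) (h : IsImage b e V u f) (n : ι) :
    inner ℂ (w n) f = μ n * inner ℂ (w n) u := by
  rw [(hw n).inner_comm hV h, inner_smul_left, Complex.conj_ofReal]

theorem hasSum_form (hV : (V : E →ₗ[ℂ] E).IsSymmetric)
    (hw : ∀ n, IsImage b e V (w n) ((μ n : ℂ) • w n)) (h : IsImage b e V u f) :
    HasSum (fun n => μ n * ‖inner ℂ (w n) u‖ ^ 2) (inner ℂ u f).re := by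
  refine (Complex.hasSum_re (w.hasSum_inner_mul_inner u f)).congr_fun fun n => ?_
  rw [inner_image w hV hw h, mul_left_comm, Complex.re_ofReal_mul, ← inner_conj_symm u (w n),
    ← Complex.normSq_eq_conj_mul_self, Complex.ofReal_re, Complex.normSq_eq_norm_sq]

theorem re_inner_image_le (hV : (V : E →ₗ[ℂ] E).IsSymmetric)
    (hw : ∀ n, IsImage b e V (w n) ((μ n : ℂ) • w n)) (h : IsImage b e V u f) {a : ℝ}
    (ha : ∀ n, a < μ n → inner ℂ (w n) u = 0) : (inner ℂ u f).re ≤ a * ‖u‖ ^ 2 := by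
  refine hasSum_le (fun n => ?_) (hasSum_form w hV hw h) ((w.hasSum_sq_norm_inner u).mul_left a)
  by_cases hn : a < μ n
  · simp [ha n hn]
  · exact mul_le_mul_of_nonneg_right (not_lt.mp hn) (sq_nonneg _)

theorem le_re_inner_image (hV : (V : E →ₗ[ℂ] E).IsSymmetric)
    (hw : ∀ n, IsImage b e V (w n) ((μ n : ℂ) • w n)) (h : IsImage b e V u f) {a : ℝ}
    (ha : ∀ n, μ n < a → inner ℂ (w n) u = 0) : a * ‖u‖ ^ 2 ≤ (inner ℂ u f).re := by
  refine hasSum_le (fun n => ?_) ((w.hasSum_sq_norm_inner u).mul_left a) (hasSum_form w hV hw h)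
  by_cases hn : μ n < a
  · simp [ha n hn]
  · exact mul_le_mul_of_nonneg_right (not_lt.mp hn) (sq_nonneg _)

theorem inner_eq_zero_of_eigen (hV : (V : E →ₗ[ℂ] E).IsSymmetric)
    (hw : ∀ n, IsImage b e V (w n) ((μ n : ℂ) • w n)) {m : ℝ} (h : IsImage b e V u ((m : ℂ) • u))
    {n : ι} (hn : μ n ≠ m) : inner ℂ (w n) u = 0 := by
  have h1 := inner_image w hV hw h n
  rw [inner_smul_right] at h1
  have h2 : ((μ n : ℂ) - m) * inner ℂ (w n) u = 0 := by rw [sub_mul, h1, sub_self]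
  rcases mul_eq_zero.mp h2 with h3 | h3
  · exact absurd (by exact_mod_cast sub_eq_zero.mp h3) hn
  · exact h3

theorem exists_eq_of_eigen (hV : (V : E →ₗ[ℂ] E).IsSymmetric)
    (hw : ∀ n, IsImage b e V (w n) ((μ n : ℂ) • w n)) {m : ℝ} (h : IsImage b e V u ((m : ℂ) • u))
    (hu : u ≠ 0) : ∃ n, μ n = m := by
  by_contra! hne
  exact hu (w.ext_inner fun n => by
    rw [inner_eq_zero_of_eigen w hV hw h (hne n), inner_zero_right])

/-- The vectors in the domain of `D + V` that lie in the spectral subspace `(-∞, a]`. -/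
def lowSpace (b : HilbertBasis J ℂ E) (e : J → ℝ) (V : E →L[ℂ] E) (w : HilbertBasis ι ℂ E)
    (μ : ι → ℝ) (a : ℝ) : Submodule ℂ E where
  carrier := {u | (∃ f, IsImage b e V u f) ∧ ∀ n, a < μ n → inner ℂ (w n) u = 0}
  zero_mem' := ⟨⟨0, .zero⟩, by simp⟩
  add_mem' := by
    rintro u v ⟨⟨f, hf⟩, hu⟩ ⟨⟨g, hg⟩, hv⟩
    exact ⟨⟨_, hf.add hg⟩, fun n hn => by rw [inner_add_right, hu n hn, hv n hn, add_zero]⟩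
  smul_mem' := by
    rintro c u ⟨⟨f, hf⟩, hu⟩
    exact ⟨⟨_, hf.smul c⟩, fun n hn => by rw [inner_smul_right, hu n hn, mul_zero]⟩

/-- The energy `x` equals the form of `D + V` minus that of `V`. The cruder first bound controls the
tail of `u` at large `e j`; the second keeps the exact `V` term, so that it can later be compared
with that of a truncation. -/
theorem energy_le_of_mem_lowSpace (hV : (V : E →ₗ[ℂ] E).IsSymmetric)
    (hw : ∀ n, IsImage b e V (w n) ((μ n : ℂ) • w n)) {a : ℝ} (hu : u ∈ lowSpace b e V w μ a) :
    ∃ x, HasSum (fun j => e j * ‖inner ℂ (b j) u‖ ^ 2) x ∧ x ≤ (a + ‖V‖) * ‖u‖ ^ 2 ∧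
      x ≤ a * ‖u‖ ^ 2 - (inner ℂ u (V u)).re := by
  obtain ⟨⟨f, hf⟩, hu⟩ := hu
  have h1 := re_inner_image_le w hV hw hf hu
  have h2 := (abs_le.mp (abs_re_inner_apply_le V u u)).1
  exact ⟨_, hf.hasSum_energy, by nlinarith, by linarith⟩

/-- The finitely many coordinates with `e j ≤ a + ‖V‖` determine `u`: if they vanish, the energy
bound leaves no room for the others. -/
theorem finiteDimensional_lowSpace (he' : Filter.Tendsto e Filter.cofinite Filter.atTop)
    (hV : (V : E →ₗ[ℂ] E).IsSymmetric)
    (hw : ∀ n, IsImage b e V (w n) ((μ n : ℂ) • w n)) (a : ℝ) :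
    FiniteDimensional ℂ (lowSpace b e V w μ a) := by
  have hfin : {j | e j ≤ a + ‖V‖}.Finite := by
    have := he'.eventually (Filter.eventually_gt_atTop (a + ‖V‖))
    simpa [Filter.eventually_cofinite] using this
  have : Finite {j | e j ≤ a + ‖V‖} := hfin
  let F : lowSpace b e V w μ a →ₗ[ℂ] ({j | e j ≤ a + ‖V‖} → ℂ) :=
    LinearMap.pi fun j => (innerₛₗ ℂ (b j)).comp (Submodule.subtype _)
  refine FiniteDimensional.of_injective F ?_
  rw [← LinearMap.ker_eq_bot, LinearMap.ker_eq_bot']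
  rintro ⟨u, hu⟩ h0
  have hj : ∀ j, e j ≤ a + ‖V‖ → inner ℂ (b j) u = 0 := fun j hj => congrFun h0 ⟨j, hj⟩
  obtain ⟨x, hx, hle, -⟩ := energy_le_of_mem_lowSpace w hV hw hu
  have h1 := hx.sub ((b.hasSum_sq_norm_inner u).mul_left (a + ‖V‖))
  have h2 : ∀ j, 0 ≤ e j * ‖inner ℂ (b j) u‖ ^ 2 - (a + ‖V‖) * ‖inner ℂ (b j) u‖ ^ 2 := by
    intro j
    by_cases h : e j ≤ a + ‖V‖
    · simp [hj j h]
    · rw [← sub_mul]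
      exact mul_nonneg (by linarith) (sq_nonneg _)
  have h3 : x - (a + ‖V‖) * ‖u‖ ^ 2 = 0 := le_antisymm (by linarith) (h1.nonneg h2)
  rw [h3, hasSum_zero_iff_of_nonneg h2] at h1
  refine Subtype.ext (b.ext_inner fun j => ?_)
  rw [Submodule.coe_zero, inner_zero_right]
  by_cases h : e j ≤ a + ‖V‖
  · exact hj j h
  · have h4 := congrFun h1 j
    simp only [Pi.zero_apply] at h4
    rw [← sub_mul, mul_eq_zero, or_iff_right (by linarith)] at h4
    exact norm_eq_zero.mp (pow_eq_zero_iff two_ne_zero |>.mp h4)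

theorem finite_eigenvalues_le (he' : Filter.Tendsto e Filter.cofinite Filter.atTop)
    (hV : (V : E →ₗ[ℂ] E).IsSymmetric)
    (hw : ∀ n, IsImage b e V (w n) ((μ n : ℂ) • w n)) (a : ℝ) : {n | μ n ≤ a}.Finite := by
  have := finiteDimensional_lowSpace w he' hV hw a
  have hmem : ∀ n : {n | μ n ≤ a}, w n ∈ lowSpace b e V w μ a := by
    rintro ⟨n, hn⟩
    refine ⟨⟨_, hw n⟩, fun k hk => w.orthonormal.inner_eq_zero ?_⟩
    rintro rfl
    exact (hk.trans_le hn).false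
  have hli : LinearIndependent ℂ fun n : {n | μ n ≤ a} =>
      (⟨w n, hmem n⟩ : lowSpace b e V w μ a) := by
    refine LinearIndependent.of_comp (Submodule.subtype _) ?_
    exact w.orthonormal.linearIndependent.comp _ Subtype.val_injective
  exact hli.finite

end Eigenbasis

end QPWave

end

noncomputable section

/-! ### Finite sections -/

theorem Matrix.IsHermitian.toEuclideanLin_eigenvectorBasis {n : Type*} [Fintype n]
    [DecidableEq n] {M : Matrix n n ℂ} (hM : M.IsHermitian) (k : n) :
    Matrix.toEuclideanLin M (hM.eigenvectorBasis k)
      = (hM.eigenvalues k : ℂ) • hM.eigenvectorBasis k := by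
  ext i
  have := congrFun (hM.mulVec_eigenvectorBasis k) i
  simpa [Matrix.toLpLin_apply] using this

namespace QPWave

universe u

variable {E : Type u} [NormedAddCommGroup E] [InnerProductSpace ℂ E] {J : Type*}
  (b : HilbertBasis J ℂ E) {e : J → ℝ} {V : E →L[ℂ] E} {B : Finset J}

/-- The inclusion of the span of the basis vectors indexed by `B`. -/
def emb (B : Finset J) : EuclideanSpace ℂ B →ₗ[ℂ] E :=
  ∑ j : B, (LinearMap.toSpanSingleton ℂ E (b j)).comp (EuclideanSpace.projₗ j)

theorem emb_apply (x : EuclideanSpace ℂ B) : emb b B x = ∑ j : B, x j • b j := by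
  simp [emb]

theorem inner_emb_left (x : EuclideanSpace ℂ B) (v : E) :
    inner ℂ (emb b B x) v = ∑ j : B, conj (x j) * inner ℂ (b j) v := by
  rw [emb_apply, sum_inner]
  simp only [inner_smul_left]

/-- The restriction of the coordinates to `B`. -/
def restr (B : Finset J) : E →ₗ[ℂ] EuclideanSpace ℂ B :=
  (WithLp.linearEquiv 2 ℂ (B → ℂ)).symm.toLinearMap ∘ₗ LinearMap.pi fun j : B => innerₛₗ ℂ (b j)

theorem restr_apply (v : E) (j : B) : restr b B v j = inner ℂ (b j) v := rfl

theorem inner_restr (v : E) (x : EuclideanSpace ℂ B) :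
    inner ℂ (restr b B v) x = inner ℂ v (emb b B x) := by
  rw [← inner_conj_symm v, inner_emb_left, map_sum, PiLp.inner_apply]
  refine Finset.sum_congr rfl fun j _ => ?_
  rw [map_mul, Complex.conj_conj, RCLike.inner_apply, restr_apply]

variable [DecidableEq J]

theorem inner_emb (j : J) (x : EuclideanSpace ℂ B) :
    inner ℂ (b j) (emb b B x) = if h : j ∈ B then x ⟨j, h⟩ else 0 := by
  rw [emb_apply, inner_sum]
  simp only [inner_smul_right, orthonormal_iff_ite.mp b.orthonormal, mul_ite, mul_one, mul_zero]
  split_ifs with h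
  · rw [Finset.sum_eq_single_of_mem ⟨j, h⟩ (Finset.mem_univ _)]
    · simp
    · intro k _ hk
      rw [if_neg]
      rintro rfl
      exact hk rfl
  · refine Finset.sum_eq_zero fun k _ => ?_
    rw [if_neg]
    rintro rfl
    exact h k.2

theorem norm_emb (x : EuclideanSpace ℂ B) : ‖emb b B x‖ = ‖x‖ := by
  have h : (inner ℂ (emb b B x) (emb b B x) : ℂ) = inner ℂ x x := by
    rw [inner_emb_left, PiLp.inner_apply]
    refine Finset.sum_congr rfl fun j _ => ?_
    rw [inner_emb, dif_pos j.2, RCLike.inner_apply, mul_comm]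
  rw [inner_self_eq_norm_sq_to_K, inner_self_eq_norm_sq_to_K] at h
  have h2 : ‖emb b B x‖ ^ 2 = ‖x‖ ^ 2 := by exact_mod_cast h
  exact (pow_left_inj₀ (norm_nonneg _) (norm_nonneg _) two_ne_zero).mp h2

/-- Extension by zero of a vector on the finite set `B` lies in the domain of `D + V`, and the form
of the compression is exactly the form of `D + V` there. Form estimates thus pass between matrix and
operator without loss. -/
theorem exists_image_emb {M : Matrix B B ℂ}
    (hM : ∀ i j : B, M i j = (if i = j then (e i : ℂ) else 0) + inner ℂ (b i) (V (b j)))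
    (x : EuclideanSpace ℂ B) :
    ∃ f, IsImage b e V (emb b B x) f ∧
      inner ℂ (emb b B x) f = inner ℂ x (Matrix.toEuclideanLin M x) := by
  let z : EuclideanSpace ℂ B := WithLp.toLp 2 fun j => (e j : ℂ) * x j
  have hf : IsImage b e V (emb b B x) (emb b B z + V (emb b B x)) := by
    intro j
    rw [inner_add_right, inner_emb, inner_emb]
    split_ifs <;> simp [z]
  refine ⟨_, hf, ?_⟩
  rw [inner_emb_left, PiLp.inner_apply]
  refine Finset.sum_congr rfl fun j _ => ?_
  rw [RCLike.inner_apply, mul_comm, hf j, inner_emb, dif_pos j.2, emb_apply, map_sum, inner_sum]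
  congr 1
  rw [Matrix.toLpLin_apply]
  simp only [Matrix.mulVec, dotProduct, hM, add_mul, Finset.sum_add_distrib, ite_mul, zero_mul,
    Finset.sum_ite_eq, Finset.mem_univ, if_true, map_smul, inner_smul_right]
  congr 1
  exact Finset.sum_congr rfl fun k _ => mul_comm _ _

theorem le_form_section {M : Matrix B B ℂ}
    (hM : ∀ i j : B, M i j = (if i = j then (e i : ℂ) else 0) + inner ℂ (b i) (V (b j)))
    {R : ℝ} (hR : ∀ j ∈ B, R ≤ e j) (x : EuclideanSpace ℂ B) :
    (R - ‖V‖) * ‖x‖ ^ 2 ≤ (inner ℂ x (Matrix.toEuclideanLin M x)).re := by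
  obtain ⟨f, hf, hfx⟩ := exists_image_emb b hM x
  rw [← hfx, ← norm_emb b x]
  have h1 : R * ‖emb b B x‖ ^ 2
      ≤ (inner ℂ (emb b B x) f).re - (inner ℂ (emb b B x) (V (emb b B x))).re := by
    refine hasSum_le (fun j => ?_) ((b.hasSum_sq_norm_inner (emb b B x)).mul_left R)
      hf.hasSum_energy
    rw [inner_emb]
    split_ifs with h
    · exact mul_le_mul_of_nonneg_right (hR j h) (sq_nonneg _)
    · simp
  have h2 := (abs_le.mp (abs_re_inner_apply_le V (emb b B x) (emb b B x))).1
  nlinarith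

theorem form_section_le {M : Matrix B B ℂ}
    (hM : ∀ i j : B, M i j = (if i = j then (e i : ℂ) else 0) + inner ℂ (b i) (V (b j)))
    {R : ℝ} (hR : ∀ j ∈ B, e j ≤ R) (x : EuclideanSpace ℂ B) :
    (inner ℂ x (Matrix.toEuclideanLin M x)).re ≤ (R + ‖V‖) * ‖x‖ ^ 2 := by
  obtain ⟨f, hf, hfx⟩ := exists_image_emb b hM x
  rw [← hfx, ← norm_emb b x]
  have h1 : (inner ℂ (emb b B x) f).re - (inner ℂ (emb b B x) (V (emb b B x))).re
      ≤ R * ‖emb b B x‖ ^ 2 := by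
    refine hasSum_le (fun j => ?_) hf.hasSum_energy
      ((b.hasSum_sq_norm_inner (emb b B x)).mul_left R)
    rw [inner_emb]
    split_ifs with h
    · exact mul_le_mul_of_nonneg_right (hR j h) (sq_nonneg _)
    · simp
  have h2 := (abs_le.mp (abs_re_inner_apply_le V (emb b B x) (emb b B x))).2
  nlinarith

variable {ι : Type u} {w : HilbertBasis ι ℂ E} {μ : ι → ℝ}

/-- The truncation `p` of `u` to `B` has no more diagonal energy than `u`. The energy bound makes
the tail `u - p` small when `R` is large, so the `V` term moves by at most `β‖u‖²`. Starting from
`-2β`, the form stays below `-β`. -/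
theorem form_restr_le (hV : (V : E →ₗ[ℂ] E).IsSymmetric)
    (hw : ∀ n, IsImage b e V (w n) ((μ n : ℂ) • w n)) (he : ∀ j, 0 ≤ e j) {M : Matrix B B ℂ}
    (hM : ∀ i j : B, M i j = (if i = j then (e i : ℂ) else 0) + inner ℂ (b i) (V (b j)))
    {β R : ℝ} (hβ : 0 < β) (hR : 0 < R) (hRB : ∀ j ∉ B, R ≤ e j)
    (hRV : 4 * ‖V‖ ^ 3 ≤ β ^ 2 * R) {u : E} (hu : u ∈ lowSpace b e V w μ (-(2 * β))) :
    (inner ℂ (restr b B u) (Matrix.toEuclideanLin M (restr b B u))).re ≤ -β * ‖u‖ ^ 2 := by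
  obtain ⟨f, hf, hfx⟩ := exists_image_emb b hM (restr b B u)
  obtain ⟨x, hx, hx1, hx2⟩ := energy_le_of_mem_lowSpace w hV hw hu
  rw [← hfx]
  set p := emb b B (restr b B u) with hp
  have hpj : ∀ j, inner ℂ (b j) p = if j ∈ B then inner ℂ (b j) u else 0 := by
    intro j
    rw [hp, inner_emb]
    rfl
  have h1 : (inner ℂ p f).re - (inner ℂ p (V p)).re ≤ x := by
    refine hasSum_le (fun j => ?_) hf.hasSum_energy hx
    rw [hpj]
    split_ifs
    · exact le_rfl
    · simpa using mul_nonneg (he j) (sq_nonneg _)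
  have h2 : R * ‖u - p‖ ^ 2 ≤ x := by
    refine hasSum_le (fun j => ?_) ((b.hasSum_sq_norm_inner (u - p)).mul_left R) hx
    rw [inner_sub_right, hpj]
    split_ifs with h
    · simpa using mul_nonneg (he j) (sq_nonneg _)
    · rw [sub_zero]
      exact mul_le_mul_of_nonneg_right (hRB j h) (sq_nonneg _)
  have h3 : ‖p‖ ≤ ‖u‖ := by
    refine abs_le_of_sq_le_sq' ?_ (norm_nonneg _) |>.2
    refine hasSum_le (fun j => ?_) (b.hasSum_sq_norm_inner p) (b.hasSum_sq_norm_inner u)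
    rw [hpj]
    split_ifs
    · exact le_rfl
    · simp
  -- The energy is at most `‖V‖ ‖u‖²`, hence `R ‖u - p‖² ≤ ‖V‖ ‖u‖²`; the condition `4‖V‖³ ≤ β²R` is
  -- what turns this into the stated bound.
  have h4 : 2 * ‖V‖ * ‖u - p‖ ≤ β * ‖u‖ := by
    refine abs_le_of_sq_le_sq' ?_ (by positivity) |>.2
    have h5 : R * ‖u - p‖ ^ 2 ≤ ‖V‖ * ‖u‖ ^ 2 := by nlinarith [sq_nonneg ‖u‖]
    have h6 : R * (2 * ‖V‖ * ‖u - p‖) ^ 2 ≤ R * (β * ‖u‖) ^ 2 :=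
      calc R * (2 * ‖V‖ * ‖u - p‖) ^ 2 = 4 * ‖V‖ ^ 2 * (R * ‖u - p‖ ^ 2) := by ring
        _ ≤ 4 * ‖V‖ ^ 2 * (‖V‖ * ‖u‖ ^ 2) := mul_le_mul_of_nonneg_left h5 (by positivity)
        _ = 4 * ‖V‖ ^ 3 * ‖u‖ ^ 2 := by ring
        _ ≤ β ^ 2 * R * ‖u‖ ^ 2 := mul_le_mul_of_nonneg_right hRV (by positivity)
        _ = _ := by ring
    exact le_of_mul_le_mul_left h6 hR
  have h7 : (inner ℂ p (V p)).re - (inner ℂ u (V u)).re ≤ β * ‖u‖ ^ 2 := by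
    have h8 := re_inner_self_sub_re_inner_self hV u p
    simp only [ContinuousLinearMap.coe_coe] at h8
    rw [h8]
    calc _ ≤ ‖V‖ * (‖p + u‖ * ‖p - u‖) := (le_abs_self _).trans (abs_re_inner_apply_le _ _ _)
      _ ≤ ‖V‖ * ((2 * ‖u‖) * ‖u - p‖) := by
        rw [norm_sub_rev p u]
        gcongr
        linarith [norm_add_le p u]
      _ = (2 * ‖V‖ * ‖u - p‖) * ‖u‖ := by ring
      _ ≤ (β * ‖u‖) * ‖u‖ := mul_le_mul_of_nonneg_right h4 (norm_nonneg _)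
      _ = _ := by ring
  linarith

/-- Truncation to `B` is injective on `N` because the form is negative on its image, which yields
`finrank N` eigenvalues at most `-β`. A vector on `B` orthogonal to that image extends by zero to a
vector orthogonal to `N`, so the complementary dimension gives eigenvalues at least `β`. The two
counts already add up to the size of `B`. -/
theorem card_eigenvalues_section (hV : (V : E →ₗ[ℂ] E).IsSymmetric)
    (hw : ∀ n, IsImage b e V (w n) ((μ n : ℂ) • w n)) (he : ∀ j, 0 ≤ e j) {M : Matrix B B ℂ}
    (hM : ∀ i j : B, M i j = (if i = j then (e i : ℂ) else 0) + inner ℂ (b i) (V (b j)))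
    (hherm : M.IsHermitian) {β R : ℝ} (hβ : 0 < β) (hR : 0 < R) (hRB : ∀ j ∉ B, R ≤ e j)
    (hRV : 4 * ‖V‖ ^ 3 ≤ β ^ 2 * R) {N : Submodule ℂ E} (hN : N ≤ lowSpace b e V w μ (-(2 * β)))
    (hN' : ∀ v f, IsImage b e V v f → (∀ u ∈ N, inner ℂ u v = 0) →
      β * ‖v‖ ^ 2 ≤ (inner ℂ v f).re) :
    Fintype.card {k // hherm.eigenvalues k < 0} = Module.finrank ℂ N ∧
      ∀ k, hherm.eigenvalues k ≤ -β ∨ β ≤ hherm.eigenvalues k := by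
  classical
  let P : N →ₗ[ℂ] EuclideanSpace ℂ B := restr b B ∘ₗ N.subtype
  have hP : ∀ u : N, (inner ℂ (P u) (Matrix.toEuclideanLin M (P u))).re ≤ -β * ‖(u : E)‖ ^ 2 :=
    fun u => form_restr_le b hV hw he hM hβ hR hRB hRV (hN u.2)
  have hPinj : Function.Injective P := by
    rw [← LinearMap.ker_eq_bot, LinearMap.ker_eq_bot']
    intro u hu
    have h1 := hP u
    rw [hu, inner_zero_left, Complex.zero_re] at h1
    have h2 : ‖(u : E)‖ ^ 2 = 0 := le_antisymm (by nlinarith) (sq_nonneg _)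
    simpa using h2
  have hPnorm : ∀ u : N, ‖P u‖ ≤ ‖(u : E)‖ := by
    intro u
    have h1 : ‖P u‖ ^ 2 ≤ ‖P u‖ * ‖(u : E)‖ :=
      calc ‖P u‖ ^ 2 = ‖inner ℂ (u : E) (emb b B (P u))‖ := by
            rw [← inner_restr, show restr b B (u : E) = P u from rfl, inner_self_eq_norm_sq_to_K]
            simp
        _ ≤ ‖(u : E)‖ * ‖emb b B (P u)‖ := norm_inner_le_norm _ _
        _ = _ := by rw [norm_emb, mul_comm]
    rcases (norm_nonneg (P u)).eq_or_lt with h0 | h0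
    · rw [← h0]
      exact norm_nonneg _
    · rw [sq] at h1
      exact le_of_mul_le_mul_left h1 h0
  have hdiag := hherm.toEuclideanLin_eigenvectorBasis
  have hrank : Module.finrank ℂ (LinearMap.range P) = Module.finrank ℂ N :=
    LinearMap.finrank_range_of_inj hPinj
  have hlow : Module.finrank ℂ N ≤ Fintype.card {k // hherm.eigenvalues k ≤ -β} := by
    rw [← hrank]
    refine hherm.eigenvectorBasis.finrank_le_card_le hdiag _ _ ?_
    rintro _ ⟨u, rfl⟩
    have h1 := pow_le_pow_left₀ (norm_nonneg _) (hPnorm u) 2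
    nlinarith [hP u]
  have hhigh : Module.finrank ℂ (LinearMap.range P)ᗮ
      ≤ Fintype.card {k // β ≤ hherm.eigenvalues k} := by
    refine hherm.eigenvectorBasis.finrank_le_card_ge hdiag _ _ fun y hy => ?_
    obtain ⟨f, hf, hfy⟩ := exists_image_emb b hM y
    rw [← hfy, ← norm_emb b y]
    refine hN' _ _ hf fun u hu => ?_
    rw [← inner_restr]
    exact (Submodule.mem_orthogonal _ _).mp hy _ ⟨⟨u, hu⟩, rfl⟩
  have hsum := (LinearMap.range P).finrank_add_finrank_orthogonal
  rw [hrank, finrank_euclideanSpace] at hsum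
  rw [Fintype.card_subtype] at hlow hhigh
  set S₁ := Finset.univ.filter fun k => hherm.eigenvalues k ≤ -β
  set S₂ := Finset.univ.filter fun k => β ≤ hherm.eigenvalues k
  have hdisj : Disjoint S₁ S₂ := by
    rw [Finset.disjoint_filter]
    intro k _ h1 h2
    linarith
  have hcard := Finset.card_union_of_disjoint hdisj
  have hle := Finset.card_le_univ (S₁ ∪ S₂)
  -- The two lower bounds sum to the full dimension, so no eigenvalue is left for the gap `(-β, β)`.
  have huniv : S₁ ∪ S₂ = Finset.univ := Finset.eq_univ_of_card _ (by omega)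
  have hdich : ∀ k, hherm.eigenvalues k ≤ -β ∨ β ≤ hherm.eigenvalues k := by
    intro k
    have := Finset.mem_univ k
    rw [← huniv, Finset.mem_union] at this
    simpa [S₁, S₂] using this
  refine ⟨?_, hdich⟩
  rw [Fintype.card_subtype]
  have : (Finset.univ.filter fun k => hherm.eigenvalues k < 0) = S₁ := by
    refine Finset.filter_congr fun k _ => ⟨fun h => ?_, fun h => by linarith⟩
    rcases hdich k with h1 | h1
    · exact h1
    · linarith
  rw [this]
  omega

end QPWave

end

noncomputable section

/-! ### The Schrödinger operator on the torus -/

namespace QPWave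

variable {d : ℕ}

instance (ι : Type) [Fintype ι] : IsProbabilityMeasure (torusMeasure ι) := by
  unfold torusMeasure
  infer_instance

theorem mFourierCoeff_eq_integral_torusMeasure {ι : Type} [Fintype ι] (f : UnitAddTorus ι → ℂ)
    (n : ι → ℤ) :
    UnitAddTorus.mFourierCoeff f n = ∫ x, UnitAddTorus.mFourier (-n) x * f x ∂torusMeasure ι :=
  rfl

/-- The exponentials, as a Hilbert basis. -/
def torusBasis (ι : Type) [Fintype ι] : HilbertBasis (ι → ℤ) ℂ (Lp ℂ 2 (torusMeasure ι)) :=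
  UnitAddTorus.mFourierBasis

theorem inner_torusBasis {ι : Type} [Fintype ι] (j : ι → ℤ) (u : Lp ℂ 2 (torusMeasure ι)) :
    inner ℂ (torusBasis ι j) u = UnitAddTorus.mFourierCoeff (⇑u) j := by
  rw [← (torusBasis ι).repr_apply_apply]
  exact UnitAddTorus.mFourierBasis_repr u j

theorem coeFn_torusBasis {ι : Type} [Fintype ι] (j : ι → ℤ) :
    torusBasis ι j =ᵐ[torusMeasure ι] UnitAddTorus.mFourier j := by
  have h : torusBasis ι j = UnitAddTorus.mFourierLp 2 j :=
    congrFun (UnitAddTorus.coe_mFourierBasis (d := ι)) j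
  rw [h]
  exact UnitAddTorus.coeFn_mFourierLp 2 j

/-- A real continuous function with complex values. -/
def toComplex {X : Type*} [TopologicalSpace X] (V : C(X, ℝ)) : C(X, ℂ) :=
  ⟨fun x => (V x : ℂ), by fun_prop⟩

/-- Multiplication by a continuous function on `L²`. -/
def mulOp {ι : Type} [Fintype ι] (V : C(UnitAddTorus ι, ℝ)) :
    Lp ℂ 2 (torusMeasure ι) →L[ℂ] Lp ℂ 2 (torusMeasure ι) :=
  (ContinuousLinearMap.mul ℂ ℂ).holderL (torusMeasure ι) ∞ 2 2
    (ContinuousMap.toLp (E := ℂ) ∞ (torusMeasure ι) ℂ (toComplex V))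

variable {ι : Type} [Fintype ι] (V : C(UnitAddTorus ι, ℝ))

theorem coeFn_mulOp (u : Lp ℂ 2 (torusMeasure ι)) :
    mulOp V u =ᵐ[torusMeasure ι] fun x => (V x : ℂ) * u x := by
  have h1 := (ContinuousLinearMap.mul ℂ ℂ).coeFn_holder (r := 2)
    (ContinuousMap.toLp (E := ℂ) ∞ (torusMeasure ι) ℂ (toComplex V)) u
  have h2 := ContinuousMap.coeFn_toLp (E := ℂ) (p := ∞) (𝕜 := ℂ) (torusMeasure ι) (toComplex V)
  filter_upwards [h1, h2] with x hx1 hx2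
  refine hx1.trans ?_
  rw [hx2]
  rfl

theorem inner_torusBasis_mulOp (j : ι → ℤ) (u : Lp ℂ 2 (torusMeasure ι)) :
    inner ℂ (torusBasis ι j) (mulOp V u)
      = UnitAddTorus.mFourierCoeff (fun x => (V x : ℂ) * u x) j := by
  rw [inner_torusBasis, mFourierCoeff_eq_integral_torusMeasure,
    mFourierCoeff_eq_integral_torusMeasure]
  refine integral_congr_ae ?_
  filter_upwards [coeFn_mulOp V u] with x hx
  rw [hx]

theorem inner_torusBasis_mulOp_torusBasis (j k : ι → ℤ) :
    inner ℂ (torusBasis ι j) (mulOp V (torusBasis ι k))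
      = UnitAddTorus.mFourierCoeff (fun x => (V x : ℂ)) (j - k) := by
  rw [inner_torusBasis_mulOp, mFourierCoeff_eq_integral_torusMeasure,
    mFourierCoeff_eq_integral_torusMeasure]
  refine integral_congr_ae ?_
  filter_upwards [coeFn_torusBasis k] with x hx
  rw [hx, neg_sub, sub_eq_add_neg, UnitAddTorus.mFourier_add]
  ring

theorem mulOp_isSymmetric : (mulOp V : Lp ℂ 2 (torusMeasure ι) →ₗ[ℂ] _).IsSymmetric := by
  intro u v
  rw [ContinuousLinearMap.coe_coe, MeasureTheory.L2.inner_def, MeasureTheory.L2.inner_def]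
  refine integral_congr_ae ?_
  filter_upwards [coeFn_mulOp V u, coeFn_mulOp V v] with x hu hv
  rw [hu, hv]
  simp only [RCLike.inner_apply, map_mul, Complex.conj_ofReal]
  ring

theorem solvesEigen_iff (V : C(UnitAddTorus (Fin d), ℝ)) (μ : ℝ)
    (u : Lp ℂ 2 (torusMeasure (Fin d))) :
    SolvesEigen V μ u ↔ IsImage (torusBasis (Fin d)) euclSq (mulOp V) u ((μ : ℂ) • u) := by
  refine forall_congr' fun j => ?_
  rw [inner_smul_right, inner_torusBasis_mulOp, inner_torusBasis, eq_comm]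

theorem euclSq_nonneg (j : Fin d → ℤ) : 0 ≤ euclSq j := Finset.sum_nonneg fun _ _ => sq_nonneg _

theorem norm_sq_le_euclSq (j : Fin d → ℤ) : ‖j‖ ^ 2 ≤ euclSq j := by
  refine Real.le_sqrt (norm_nonneg _) (euclSq_nonneg j) |>.mp ?_
  refine (pi_norm_le_iff_of_nonneg (Real.sqrt_nonneg _)).mpr fun k => ?_
  refine Real.le_sqrt (norm_nonneg _) (euclSq_nonneg j) |>.mpr ?_
  rw [Int.norm_eq_abs, sq_abs]
  exact Finset.single_le_sum (f := fun k => (j k : ℝ) ^ 2) (fun _ _ => sq_nonneg _)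
    (Finset.mem_univ k)

theorem euclSq_le (j : Fin d → ℤ) : euclSq j ≤ d * ‖j‖ ^ 2 := by
  calc euclSq j ≤ ∑ _k : Fin d, ‖j‖ ^ 2 := by
        refine Finset.sum_le_sum fun k _ => ?_
        have := norm_le_pi_norm j k
        rw [Int.norm_eq_abs] at this
        rw [← sq_abs]
        exact pow_le_pow_left₀ (abs_nonneg _) this 2
    _ = _ := by simp

theorem tendsto_euclSq :
    Filter.Tendsto (euclSq (d := d)) Filter.cofinite Filter.atTop := by
  refine Filter.tendsto_atTop.mpr fun a => ?_
  rw [Filter.eventually_cofinite]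
  have hfin : (Metric.closedBall (0 : Fin d → ℤ) (|a| + 1)).Finite :=
    (isCompact_closedBall _ _).finite_of_discrete
  refine hfin.subset fun j hj => ?_
  rw [mem_closedBall_zero_iff]
  by_contra! hlt
  apply hj
  have h1 := norm_sq_le_euclSq j
  have h2 := le_abs_self a
  have h3 := abs_nonneg a
  nlinarith

theorem schrodinger_apply (V : C(UnitAddTorus (Fin d), ℝ)) (j k : Fin d → ℤ) :
    schrodinger V j k = (if j = k then (euclSq j : ℂ) else 0)
      + inner ℂ (torusBasis (Fin d) j) (mulOp V (torusBasis (Fin d) k)) := by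
  rw [inner_torusBasis_mulOp_torusBasis]
  rfl

theorem schrodingerOn_apply (V : C(UnitAddTorus (Fin d), ℝ)) (B : Finset (Fin d → ℤ)) (j k : B) :
    schrodingerOn V B j k = (if j = k then (euclSq (j : Fin d → ℤ) : ℂ) else 0)
      + inner ℂ (torusBasis (Fin d) j) (mulOp V (torusBasis (Fin d) k)) := by
  rw [schrodingerOn, Matrix.submatrix_apply, schrodinger_apply]
  simp only [Subtype.ext_iff]

theorem exists_schrodinger_eigenbasis (V : C(UnitAddTorus (Fin d), ℝ)) :
    ∃ (κ : Type) (w : HilbertBasis κ ℂ (Lp ℂ 2 (torusMeasure (Fin d)))) (μ : κ → ℝ),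
      ∀ n, IsImage (torusBasis (Fin d)) euclSq (mulOp V) (w n) ((μ n : ℂ) • w n) :=
  exists_eigenbasis (torusBasis (Fin d)) euclSq_nonneg tendsto_euclSq (mulOp_isSymmetric V)

/-! ### Positivity of the spectral gap `β₀`. -/

section Beta

variable (V : C(UnitAddTorus (Fin d), ℝ))

/-- The set whose infimum is `β₀`. -/
def gapSet : Set ℝ :=
  {x | ∃ μ, IsEigenvalue V μ ∧ ((μ < 0 ∧ x = |μ| / 2) ∨ (0 < μ ∧ x = μ))}

theorem gapSet_nonneg {x : ℝ} (hx : x ∈ gapSet V) : 0 ≤ x := by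
  obtain ⟨μ, -, ⟨-, rfl⟩ | ⟨h, rfl⟩⟩ := hx
  · positivity
  · exact h.le

theorem beta0_le {x : ℝ} (hx : x ∈ gapSet V) : beta0 V ≤ x :=
  csInf_le ⟨0, fun _ h => gapSet_nonneg V h⟩ hx

theorem beta0_le_of_pos {μ : ℝ} (hμ : IsEigenvalue V μ) (h : 0 < μ) : beta0 V ≤ μ :=
  beta0_le V ⟨μ, hμ, Or.inr ⟨h, rfl⟩⟩

theorem le_neg_beta0_of_neg {μ : ℝ} (hμ : IsEigenvalue V μ) (h : μ < 0) :
    μ ≤ -(2 * beta0 V) := by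
  have := beta0_le V ⟨μ, hμ, Or.inl ⟨h, rfl⟩⟩
  rw [abs_of_neg h] at this
  linarith

theorem not_isEigenvalue_zero (hV : TrivialKernel V) : ¬ IsEigenvalue V 0 :=
  fun ⟨u, hu, h⟩ => hu (hV u h)

theorem isEigenvalue_eigenbasis {κ : Type}
    {w : HilbertBasis κ ℂ (Lp ℂ 2 (torusMeasure (Fin d)))} {μ : κ → ℝ}
    (hw : ∀ n, IsImage (torusBasis (Fin d)) euclSq (mulOp V) (w n) ((μ n : ℂ) • w n)) (n : κ) :
    IsEigenvalue V (μ n) :=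
  ⟨w n, w.orthonormal.ne_zero n, (solvesEigen_iff V _ _).mpr (hw n)⟩

theorem beta0_pos (hV : TrivialKernel V) : 0 < beta0 V := by
  obtain ⟨κ, w, μ, hw⟩ := exists_schrodinger_eigenbasis V
  have hev : ∀ n, IsEigenvalue V (μ n) := isEigenvalue_eigenbasis V hw
  have hne : ∀ n, μ n ≠ 0 := fun n h0 => not_isEigenvalue_zero V hV (h0 ▸ hev n)
  have hex : ∀ m, IsEigenvalue V m → ∃ n, μ n = m := fun m ⟨u, hu, h⟩ =>
    exists_eq_of_eigen w (mulOp_isSymmetric V) hw ((solvesEigen_iff V _ _).mp h) hu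
  have hfin := finite_eigenvalues_le w tendsto_euclSq (mulOp_isSymmetric V) hw 1
  -- Nonemptiness matters: the infimum of the empty set of reals is `0` by convention.
  have hnonempty : (gapSet V).Nonempty := by
    have : Nonempty κ := by
      by_contra hempty
      rw [not_nonempty_iff] at hempty
      exact (torusBasis (Fin d)).orthonormal.ne_zero 0 (w.ext_inner fun n => isEmptyElim n)
    obtain ⟨n⟩ := this
    rcases (hne n).lt_or_gt with h | h
    · exact ⟨_, μ n, hev n, Or.inl ⟨h, rfl⟩⟩
    · exact ⟨_, μ n, hev n, Or.inr ⟨h, rfl⟩⟩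
  -- Only finitely many eigenvalues are at most `1`. Half their moduli bound their entries in
  -- `gapSet` from below for either sign, and the element `1` covers all larger eigenvalues.
  let s : Finset ℝ := insert 1 (hfin.toFinset.image fun n => |μ n| / 2)
  have hs : s.Nonempty := ⟨1, Finset.mem_insert_self _ _⟩
  have hspos : 0 < s.min' hs := by
    rw [Finset.lt_min'_iff]
    intro y hy
    rcases Finset.mem_insert.mp hy with rfl | hy
    · exact one_pos
    · obtain ⟨n, -, rfl⟩ := Finset.mem_image.mp hy
      have := abs_pos.mpr (hne n)
      positivity
  refine hspos.trans_le (le_csInf hnonempty ?_)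
  rintro x ⟨m, hm, hx⟩
  obtain ⟨n, rfl⟩ := hex m hm
  by_cases h1 : μ n ≤ 1
  · have hmem : |μ n| / 2 ∈ s :=
      Finset.mem_insert_of_mem (Finset.mem_image_of_mem (fun n => |μ n| / 2)
        (hfin.mem_toFinset.mpr h1))
    refine (s.min'_le _ hmem).trans ?_
    rcases hx with ⟨-, rfl⟩ | ⟨h, rfl⟩
    · exact le_rfl
    · rw [abs_of_pos h]
      linarith
  · refine (s.min'_le _ (Finset.mem_insert_self _ _)).trans ?_
    rcases hx with ⟨h, rfl⟩ | ⟨h, rfl⟩ <;> linarith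

end Beta

/-! ### Existence of an admissible radius. -/

theorem posSemidef_sub_smul_one_iff {n : Type*} [Fintype n] [DecidableEq n] {M : Matrix n n ℂ}
    (hM : M.IsHermitian) (a : ℝ) :
    (M - (a : ℂ) • (1 : Matrix n n ℂ)).PosSemidef ↔
      ∀ x : EuclideanSpace ℂ n, a * ‖x‖ ^ 2 ≤ (inner ℂ x (Matrix.toEuclideanLin M x)).re := by
  have hherm : (M - (a : ℂ) • (1 : Matrix n n ℂ)).IsHermitian := by
    refine hM.sub ?_
    rw [Matrix.IsHermitian, Matrix.conjTranspose_smul, Matrix.conjTranspose_one, RCLike.star_def,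
      Complex.conj_ofReal]
  have hform : ∀ x : EuclideanSpace ℂ n,
      star x.ofLp ⬝ᵥ ((M - (a : ℂ) • (1 : Matrix n n ℂ)).mulVec x.ofLp)
        = inner ℂ x (Matrix.toEuclideanLin M x) - ((a * ‖x‖ ^ 2 : ℝ) : ℂ) := by
    intro x
    have h1 : (inner ℂ x x : ℂ) = ((‖x‖ ^ 2 : ℝ) : ℂ) := by
      rw [inner_self_eq_norm_sq_to_K]
      simp
    rw [Complex.ofReal_mul, ← h1, EuclideanSpace.inner_eq_star_dotProduct,
      EuclideanSpace.inner_eq_star_dotProduct, Matrix.toLpLin_apply, Matrix.sub_mulVec,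
      Matrix.smul_mulVec, Matrix.one_mulVec, dotProduct_sub, dotProduct_smul, smul_eq_mul,
      dotProduct_comm, dotProduct_comm (star x.ofLp)]
  have hreal : ∀ x : EuclideanSpace ℂ n, (inner ℂ x (Matrix.toEuclideanLin M x)).im = 0 := by
    intro x
    rw [← Complex.conj_eq_iff_im, inner_conj_symm]
    exact (Matrix.isSymmetric_toEuclideanLin_iff.mpr hM) x x
  rw [Matrix.posSemidef_iff_dotProduct_mulVec, and_iff_right hherm]
  constructor
  · intro h x
    have h1 := h x.ofLp
    rw [hform, Complex.nonneg_iff, Complex.sub_re, Complex.ofReal_re] at h1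
    linarith [h1.1]
  · intro h x
    have h1 := hform (WithLp.toLp 2 x)
    rw [h1, Complex.nonneg_iff, Complex.sub_re, Complex.ofReal_re, Complex.sub_im,
      Complex.ofReal_im, hreal]
    exact ⟨by linarith [h (WithLp.toLp 2 x)], by simp⟩

theorem exists_isSpectralRadius (V : C(UnitAddTorus (Fin d), ℝ)) (hV : TrivialKernel V) :
    ∃ L : ℕ, IsSpectralRadius V L := by
  have hβ := beta0_pos V hV
  set β := beta0 V with hβdef
  set v := ‖mulOp V‖ with hv
  have hv0 : 0 ≤ v := norm_nonneg _
  -- The summand `1` gives `L ≤ L²`; then `β + v ≤ L²` handles sets away from the origin, and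
  -- `4v³/β² ≤ L²` is the truncation condition with `R = L²`.
  obtain ⟨L, hL⟩ := exists_nat_ge (1 + β + v + 4 * v ^ 3 / β ^ 2)
  have hdiv : 0 ≤ 4 * v ^ 3 / β ^ 2 := by positivity
  have hL1 : (1 : ℝ) ≤ L := by linarith
  have hLsq : (L : ℝ) ≤ (L : ℝ) ^ 2 := by nlinarith
  have hM : ∀ (B : Finset (Fin d → ℤ)) (i j : B), schrodingerOn V B i j = _ :=
    fun B i j => schrodingerOn_apply V B i j
  refine ⟨L, fun B hB hbd => ⟨fun hdisj => ?_, fun hball => ?_⟩⟩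
  · rw [posSemidef_sub_smul_one_iff (schrodingerOn_isHermitian V B)]
    intro x
    have h1 := le_form_section (torusBasis (Fin d)) (hM B) (R := (L : ℝ) ^ 2) (fun j hj => by
      have h2 : (L : ℝ) ≤ ‖j‖ := not_lt.mp fun h => hdisj j h hj
      exact (pow_le_pow_left₀ (by positivity) h2 2).trans (norm_sq_le_euclSq j)) x
    refine le_trans (mul_le_mul_of_nonneg_right ?_ (sq_nonneg _)) h1
    linarith
  · obtain ⟨κ, w, μ, hw⟩ := exists_schrodinger_eigenbasis V
    have hsymm := mulOp_isSymmetric V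
    have hev : ∀ n, IsEigenvalue V (μ n) := isEigenvalue_eigenbasis V hw
    refine card_eigenvalues_section (torusBasis (Fin d)) hsymm hw euclSq_nonneg (hM B)
      (schrodingerOn_isHermitian V B) hβ (R := (L : ℝ) ^ 2) (by positivity) ?_ ?_ ?_ ?_
    · intro j hj
      have h2 : (L : ℝ) ≤ ‖j‖ := not_lt.mp fun h => hj (hball j h.le)
      exact (pow_le_pow_left₀ (by positivity) h2 2).trans (norm_sq_le_euclSq j)
    · have h3 : 4 * v ^ 3 / β ^ 2 ≤ (L : ℝ) ^ 2 := by linarith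
      rwa [div_le_iff₀' (by positivity)] at h3
    · rw [Submodule.span_le]
      rintro u ⟨m, hm, hu⟩
      rw [solvesEigen_iff] at hu
      refine ⟨⟨_, hu⟩, fun n hn => inner_eq_zero_of_eigen w hsymm hw hu ?_⟩
      rintro rfl
      exact absurd (le_neg_beta0_of_neg V (hev n) hm) (not_le.mpr hn)
    · intro u f hf hu
      refine le_re_inner_image w hsymm hw hf fun n hn => ?_
      rcases lt_trichotomy (μ n) 0 with h | h | h
      · exact hu _ (Submodule.subset_span ⟨μ n, h, (solvesEigen_iff V _ _).mpr (hw n)⟩)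
      · exact absurd (h ▸ hev n) (not_isEigenvalue_zero V hV)
      · exact absurd (beta0_le_of_pos V (hev n) h) (not_le.mpr hn)

end QPWave

end

noncomputable section

/-! ### Operator norms of finite sections -/

namespace QPWave

theorem l2norm_eq_ofReal_norm {ι : Type} [Fintype ι] (x : EuclideanSpace ℂ ι) :
    l2norm x.ofLp = ENNReal.ofReal ‖x‖ := by
  rw [l2norm, tsum_fintype, EuclideanSpace.norm_eq, Real.sqrt_eq_rpow,
    ← ENNReal.ofReal_rpow_of_nonneg (Finset.sum_nonneg fun _ _ => sq_nonneg _) (by norm_num),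
    ENNReal.ofReal_sum_of_nonneg fun _ _ => sq_nonneg _]
  congr 2
  ext i
  rw [ENNReal.ofReal_pow (norm_nonneg _), ofReal_norm]

theorem l2norm_le_opNorm_mul {ι : Type} (M : Matrix ι ι ℂ) (h : ι →₀ ℂ) :
    l2norm (fun i => h.sum fun k c => M i k * c) ≤ opNorm M * l2norm ⇑h := by
  by_cases h0 : h = 0
  · simp [h0, l2norm]
  · have hne : l2norm ⇑h ≠ 0 := by
      intro hz
      apply h0
      rw [l2norm, ENNReal.rpow_eq_zero_iff_of_pos (by norm_num), ENNReal.tsum_eq_zero] at hz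
      ext i
      simpa using hz i
    have htop : l2norm ⇑h ≠ ⊤ := by
      rw [l2norm]
      refine ENNReal.rpow_ne_top_of_nonneg (by norm_num) ?_
      rw [tsum_eq_sum (s := h.support) fun i hi => by simp [Finsupp.notMem_support_iff.mp hi]]
      exact ENNReal.sum_ne_top.mpr fun i _ => ENNReal.pow_ne_top enorm_ne_top
    rw [← ENNReal.div_le_iff hne htop]
    exact le_iSup₂_of_le (f := fun (h : ι →₀ ℂ) (_ : h ≠ 0) =>
      l2norm (fun i => h.sum fun k c => M i k * c) / l2norm ⇑h) h h0 le_rfl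

/-- Extension by zero followed by restriction does not increase norms. The factor `ε` is kept inside
so that `ε = 0` is covered even when `opNorm M` is infinite. -/
theorem mul_norm_section_le {ι : Type} [DecidableEq ι] {M : Matrix ι ι ℂ} {ε c : ℝ} (hε : 0 ≤ ε)
    (hc : 0 ≤ c)
    (hM : ENNReal.ofReal ε * opNorm M ≤ ENNReal.ofReal c) (S : Finset ι)
    (x : EuclideanSpace ℂ S) :
    ε * ‖Matrix.toEuclideanLin (M.submatrix Subtype.val Subtype.val : Matrix S S ℂ) x‖
      ≤ c * ‖x‖ := by
  set y := Matrix.toEuclideanLin (M.submatrix Subtype.val Subtype.val : Matrix S S ℂ) x with hy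
  let h : ι →₀ ℂ := Finsupp.embDomain (Function.Embedding.subtype _)
    (Finsupp.equivFunOnFinite.symm x.ofLp)
  have hsum : ∀ i, (h.sum fun k c => M i k * c) = ∑ k : S, M i k * x k := by
    intro i
    rw [Finsupp.sum_embDomain, Finsupp.sum_fintype _ _ (by simp)]
    rfl
  have hval : ∀ k : S, h k = x k := fun k =>
    Finsupp.embDomain_apply_self (Function.Embedding.subtype _) _ k
  have hzero : ∀ i, i ∉ S → h i = 0 := fun i hi =>
    Finsupp.embDomain_of_notMem_range _ _ _ (by simpa using hi)
  have h1 : l2norm ⇑h = ENNReal.ofReal ‖x‖ := by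
    rw [← l2norm_eq_ofReal_norm, l2norm, l2norm,
      tsum_eq_sum (s := S) fun i hi => by simp [hzero i hi], tsum_fintype]
    congr 1
    rw [← Finset.sum_coe_sort]
    exact Finset.sum_congr rfl fun k _ => by rw [hval]
  have h2 : ENNReal.ofReal ‖y‖ ≤ l2norm (fun i => h.sum fun k c => M i k * c) := by
    rw [← l2norm_eq_ofReal_norm, l2norm, l2norm]
    refine ENNReal.rpow_le_rpow ?_ (by norm_num)
    refine le_trans (le_of_eq ?_) (ENNReal.tsum_comp_le_tsum_of_injective
      (Subtype.val_injective (p := fun i => i ∈ S)) _)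
    refine tsum_congr fun i => ?_
    rw [hsum, hy, Matrix.toLpLin_apply]
    rfl
  have h3 : ENNReal.ofReal (ε * ‖y‖) ≤ ENNReal.ofReal (c * ‖x‖) := by
    rw [ENNReal.ofReal_mul hε, ENNReal.ofReal_mul hc, ← h1]
    calc _ ≤ ENNReal.ofReal ε * (opNorm M * l2norm ⇑h) :=
          mul_le_mul_right (h2.trans (l2norm_le_opNorm_mul M h)) _
      _ = ENNReal.ofReal ε * opNorm M * l2norm ⇑h := (mul_assoc _ _ _).symm
      _ ≤ _ := mul_le_mul_left hM _
  exact (ENNReal.ofReal_le_ofReal_iff (by positivity)).mp h3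

/-- Otherwise `‖x‖ ≤ K‖Mx‖` for all `x`, which makes `M` injective, hence invertible, with inverse
of norm at most `K`. Singular matrices and large inverses are thus treated together. -/
theorem exists_norm_le_of_lt_invNorm {ι : Type} [Fintype ι] [DecidableEq ι] {M : Matrix ι ι ℂ}
    {K : ℝ} (hK : 0 < K) (hM : ENNReal.ofReal K < invNorm M) :
    ∃ x : EuclideanSpace ℂ ι, x ≠ 0 ∧ ‖Matrix.toEuclideanLin M x‖ ≤ K⁻¹ * ‖x‖ := by
  by_contra! hbd
  have hle : ∀ x : EuclideanSpace ℂ ι, ‖x‖ ≤ K * ‖Matrix.toEuclideanLin M x‖ := by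
    intro x
    by_cases hx : x = 0
    · simp [hx]
    · have := hbd x hx
      rw [inv_mul_lt_iff₀ hK] at this
      exact this.le
  have hunit : IsUnit M := by
    rw [← Matrix.mulVec_injective_iff_isUnit]
    intro x y hxy
    have h1 := hle (WithLp.toLp 2 (x - y))
    rw [Matrix.toLpLin_apply, Matrix.mulVec_sub, hxy, sub_self] at h1
    have h2 : (WithLp.toLp 2 (x - y) : EuclideanSpace ℂ ι) = 0 := by simpa using h1
    have h3 : x - y = 0 := congrArg WithLp.ofLp h2
    exact sub_eq_zero.mp h3
  rw [invNorm, if_pos hunit] at hM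
  refine absurd (iSup₂_le fun h hh => ?_) (not_le.mpr hM)
  let z : EuclideanSpace ℂ ι := WithLp.toLp 2 (M⁻¹.mulVec ⇑h)
  have h1 : (fun i => h.sum fun k c => M⁻¹ i k * c) = z.ofLp := by
    ext i
    rw [Finsupp.sum_fintype _ _ (by simp)]
    rfl
  have h2 : ⇑h = (WithLp.toLp 2 ⇑h : EuclideanSpace ℂ ι).ofLp := rfl
  have h3 : Matrix.toEuclideanLin M z = WithLp.toLp 2 ⇑h := by
    rw [Matrix.toLpLin_apply, Matrix.mulVec_mulVec,
      Matrix.mul_nonsing_inv _ ((Matrix.isUnit_iff_isUnit_det M).mp hunit), Matrix.one_mulVec]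
  rw [h1, h2, l2norm_eq_ofReal_norm, l2norm_eq_ofReal_norm, ← h3]
  refine ENNReal.div_le_of_le_mul ?_
  rw [← ENNReal.ofReal_mul hK.le]
  exact ENNReal.ofReal_le_ofReal (hle z)

/-! ### Töplitz matrices -/

theorem integrable_mFourier_mul {ι : Type} [Fintype ι] (n : ι → ℤ) (g : C(UnitAddTorus ι, ℝ)) :
    Integrable (fun x => UnitAddTorus.mFourier (-n) x * (g x : ℂ)) (torusMeasure ι) :=
  Continuous.integrable_of_hasCompactSupport (by fun_prop) (HasCompactSupport.of_compactSpace _)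

/-- The Fourier coefficient as a continuous functional. -/
def coeffCLM {ι : Type} [Fintype ι] (n : ι → ℤ) : C(UnitAddTorus ι, ℝ) →L[ℝ] ℂ :=
  LinearMap.mkContinuous
    { toFun := fun g => UnitAddTorus.mFourierCoeff (fun x => (g x : ℂ)) n
      map_add' := fun g g' => by
        simp only [mFourierCoeff_eq_integral_torusMeasure, ContinuousMap.add_apply,
          Complex.ofReal_add, mul_add]
        exact integral_add (integrable_mFourier_mul n g) (integrable_mFourier_mul n g')
      map_smul' := fun c g => by
        simp only [mFourierCoeff_eq_integral_torusMeasure, ContinuousMap.smul_apply, smul_eq_mul,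
          Complex.ofReal_mul, RingHom.id_apply, mul_left_comm _ (c : ℂ)]
        rw [integral_const_mul, Complex.real_smul] }
    1 fun g => by
      simp only [LinearMap.coe_mk, AddHom.coe_mk, mFourierCoeff_eq_integral_torusMeasure]
      refine (norm_integral_le_of_norm_le_const (C := ‖g‖) (.of_forall fun x => ?_)).trans ?_
      · rw [norm_mul, Complex.norm_real]
        have h1 := (UnitAddTorus.mFourier (-n)).norm_coe_le_norm x
        rw [UnitAddTorus.mFourier_norm] at h1
        have h2 := g.norm_coe_le_norm x
        nlinarith [norm_nonneg (g x), norm_nonneg (UnitAddTorus.mFourier (-n) x)]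
      · simp

theorem coeffCLM_apply {ι : Type} [Fintype ι] (n : ι → ℤ) (g : C(UnitAddTorus ι, ℝ)) :
    coeffCLM n g = UnitAddTorus.mFourierCoeff (fun x => (g x : ℂ)) n := rfl

theorem conj_coeffCLM {ι : Type} [Fintype ι] (n : ι → ℤ) (g : C(UnitAddTorus ι, ℝ)) :
    conj (coeffCLM n g) = coeffCLM (-n) g := by
  rw [coeffCLM_apply, coeffCLM_apply, mFourierCoeff_eq_integral_torusMeasure,
    mFourierCoeff_eq_integral_torusMeasure, ← integral_conj]
  refine integral_congr_ae (.of_forall fun x => ?_)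
  simp [UnitAddTorus.mFourier_neg]

variable {ν d : ℕ}

/-- A finite section of a Töplitz matrix. -/
def mulSection (S : Finset (Idx ν d)) (g : C(UnitAddTorus (Fin ν ⊕ Fin d), ℝ)) : Matrix S S ℂ :=
  (mulMatrix g).submatrix Subtype.val Subtype.val

variable (S : Finset (Idx ν d))

theorem mulSection_apply (g : C(UnitAddTorus (Fin ν ⊕ Fin d), ℝ)) (i k : S) :
    mulSection S g i k
      = coeffCLM (Sum.elim (i.1.1 - k.1.1) (i.1.2 - k.1.2)) g := rfl

theorem mulSection_isHermitian (g : C(UnitAddTorus (Fin ν ⊕ Fin d), ℝ)) :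
    (mulSection S g).IsHermitian := by
  ext i k
  rw [Matrix.conjTranspose_apply, mulSection_apply, mulSection_apply, RCLike.star_def,
    conj_coeffCLM]
  refine congrArg (fun n => coeffCLM n g) (funext fun a => ?_)
  rcases a with a | a <;> simp

/-- The quadratic form of a finite section of a Töplitz matrix, as a functional of the symbol. -/
def formCLM (x : EuclideanSpace ℂ S) : C(UnitAddTorus (Fin ν ⊕ Fin d), ℝ) →L[ℝ] ℝ :=
  ∑ i : S, ∑ k : S, Complex.reCLM.comp
    ((conj (x i) * x k) • coeffCLM (Sum.elim (i.1.1 - k.1.1) (i.1.2 - k.1.2)))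

theorem formCLM_apply (x : EuclideanSpace ℂ S) (g : C(UnitAddTorus (Fin ν ⊕ Fin d), ℝ)) :
    formCLM S x g = (inner ℂ x (Matrix.toEuclideanLin (mulSection S g) x)).re := by
  simp only [formCLM, sum_apply, ContinuousLinearMap.comp_apply, smul_apply,
    Complex.reCLM_apply, PiLp.inner_apply, Complex.re_sum]
  refine Finset.sum_congr rfl fun i _ => ?_
  rw [← Complex.re_sum, RCLike.inner_apply, Matrix.toLpLin_apply]
  simp only [Matrix.mulVec, dotProduct, Finset.sum_mul, mulSection_apply]
  congr 1
  refine Finset.sum_congr rfl fun k _ => ?_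
  rw [smul_eq_mul]
  ring

/-- For a fixed vector the form is a continuous linear functional of the symbol, so its derivative
in the parameter is the form of multiplication by the derivative of `g`. The mean value inequality
then suffices. -/
theorem abs_form_sub_le {ε c : ℝ} (hε : 0 ≤ ε) (hc : 0 ≤ c)
    {g : ℝ → C(UnitAddTorus (Fin ν ⊕ Fin d), ℝ)} (hg : ContDiffOn ℝ 1 g Lam)
    (hgc : ∀ t ∈ Lam, ENNReal.ofReal ε * opNorm (mulMatrix (derivWithin g Lam t))
      ≤ ENNReal.ofReal c) {t t' : ℝ} (ht : t ∈ Lam) (ht' : t' ∈ Lam) (x : EuclideanSpace ℂ S) :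
    ε * |(inner ℂ x (Matrix.toEuclideanLin (mulSection S (g t')) x)).re
      - (inner ℂ x (Matrix.toEuclideanLin (mulSection S (g t)) x)).re|
      ≤ c * |t' - t| * ‖x‖ ^ 2 := by
  have hd : ∀ s ∈ Lam, HasDerivWithinAt (fun s => ε * formCLM S x (g s))
      (ε * formCLM S x (derivWithin g Lam s)) Lam s := fun s hs =>
    ((formCLM S x).hasFDerivAt.comp_hasDerivWithinAt s
      (hg.differentiableOn one_ne_zero s hs).hasDerivWithinAt).const_mul ε
  have hb : ∀ s ∈ Lam, ‖ε * formCLM S x (derivWithin g Lam s)‖ ≤ c * ‖x‖ ^ 2 := by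
    intro s hs
    rw [formCLM_apply, Real.norm_eq_abs, abs_mul, abs_of_nonneg hε]
    calc _ ≤ ε * (‖x‖ * ‖Matrix.toEuclideanLin (mulSection S (derivWithin g Lam s)) x‖) :=
          mul_le_mul_of_nonneg_left
            ((Complex.abs_re_le_norm _).trans (norm_inner_le_norm _ _)) hε
      _ = ‖x‖ * (ε * ‖Matrix.toEuclideanLin (mulSection S (derivWithin g Lam s)) x‖) := by ring
      _ ≤ ‖x‖ * (c * ‖x‖) := mul_le_mul_of_nonneg_left
          (mul_norm_section_le hε hc (hgc s hs) S x) (norm_nonneg _)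
      _ = _ := by ring
  have h := (convex_Icc (1 / 2 : ℝ) (3 / 2)).norm_image_sub_le_of_norm_hasDerivWithin_le hd hb
    ht ht'
  rw [← mul_sub, norm_mul, Real.norm_of_nonneg hε, formCLM_apply, formCLM_apply] at h
  rw [Real.norm_eq_abs, Real.norm_eq_abs] at h
  linarith

end QPWave

end

noncomputable section

namespace QPWave

/-! ### Bases adapted to block-diagonal matrices -/

section Product

variable {α γ σ : Type} [Fintype α] [Fintype γ] [Fintype σ] [DecidableEq α] [DecidableEq γ]

/-- The vectors `e_l ⊗ ψ_k`. -/
def productVec (φ : σ ≃ α × γ) (ψ : OrthonormalBasis γ ℂ (EuclideanSpace ℂ γ)) (p : α × γ) :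
    EuclideanSpace ℂ σ :=
  WithLp.toLp 2 fun i => if (φ i).1 = p.1 then ψ p.2 (φ i).2 else 0

theorem orthonormal_productVec (φ : σ ≃ α × γ)
    (ψ : OrthonormalBasis γ ℂ (EuclideanSpace ℂ γ)) : Orthonormal ℂ (productVec φ ψ) := by
  rw [orthonormal_iff_ite]
  rintro ⟨l, k⟩ ⟨l', k'⟩
  rw [PiLp.inner_apply, ← φ.symm.sum_comp, Fintype.sum_prod_type]
  simp only [productVec, Equiv.apply_symm_apply]
  have h : ∀ a, (∑ c, inner ℂ (if a = l then ψ k c else 0) (if a = l' then ψ k' c else 0) : ℂ)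
      = if a = l ∧ a = l' then inner ℂ (ψ k) (ψ k') else 0 := by
    intro a
    by_cases h1 : a = l
    · by_cases h2 : a = l'
      · simp only [if_pos h1, if_pos h2, if_pos (And.intro h1 h2), PiLp.inner_apply]
      · simp [h2]
    · simp [h1]
  simp only [h, orthonormal_iff_ite.mp ψ.orthonormal, Prod.mk.injEq]
  by_cases hl : l = l'
  · subst hl
    simp
  · rw [if_neg (show ¬(l = l' ∧ k = k') from fun hh => hl hh.1)]
    refine Finset.sum_eq_zero fun a _ => ?_
    rw [if_neg]
    rintro ⟨rfl, rfl⟩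
    exact hl rfl

/-- The orthonormal basis `e_l ⊗ ψ_k`. -/
def productBasis (φ : σ ≃ α × γ) (ψ : OrthonormalBasis γ ℂ (EuclideanSpace ℂ γ)) :
    OrthonormalBasis (α × γ) ℂ (EuclideanSpace ℂ σ) :=
  OrthonormalBasis.mk (orthonormal_productVec φ ψ) (by
    rw [top_le_iff]
    refine (orthonormal_productVec φ ψ).linearIndependent.span_eq_top_of_card_eq_finrank' ?_
    rw [finrank_euclideanSpace, Fintype.card_congr φ])

theorem productBasis_apply (φ : σ ≃ α × γ) (ψ : OrthonormalBasis γ ℂ (EuclideanSpace ℂ γ))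
    (p : α × γ) : productBasis φ ψ p = productVec φ ψ p := by
  rw [productBasis, OrthonormalBasis.coe_mk]

/-- In the coordinates `φ` the matrix is `diag(y) ⊗ 1 + 1 ⊗ H`, so tensors of unit vectors with
eigenvectors of `H` diagonalise it. -/
theorem toEuclideanLin_eq_diagonalOp [DecidableEq σ] (φ : σ ≃ α × γ) {H : Matrix γ γ ℂ}
    (ψ : OrthonormalBasis γ ℂ (EuclideanSpace ℂ γ)) {h : γ → ℝ}
    (hψ : ∀ k, Matrix.toEuclideanLin H (ψ k) = (h k : ℂ) • ψ k) (y : α → ℝ) {Q : Matrix σ σ ℂ}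
    (hQ : ∀ i j, Q i j = (if i = j then (y (φ i).1 : ℂ) else 0)
      + if (φ i).1 = (φ j).1 then H (φ i).2 (φ j).2 else 0) :
    Matrix.toEuclideanLin Q = (productBasis φ ψ).diagonalOp fun p => y p.1 + h p.2 := by
  refine (productBasis φ ψ).toBasis.ext fun p => ?_
  rw [OrthonormalBasis.coe_toBasis, OrthonormalBasis.diagonalOp_apply_basis, productBasis_apply]
  ext i
  rw [Matrix.toLpLin_apply]
  simp only [Matrix.mulVec, dotProduct, hQ, add_mul, Finset.sum_add_distrib, ite_mul, zero_mul,
    Finset.sum_ite_eq, Finset.mem_univ, if_true]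
  rw [← φ.symm.sum_comp, Fintype.sum_prod_type]
  simp only [productVec, Equiv.apply_symm_apply, PiLp.smul_apply, smul_eq_mul, Complex.ofReal_add,
    Finset.sum_ite_irrel, Finset.sum_const_zero, Finset.sum_ite_eq, Finset.mem_univ, if_true]
  have h2 : (∑ c, H (φ i).2 c * ψ p.2 c) = h p.2 * ψ p.2 (φ i).2 := by
    have := congrArg (fun v : EuclideanSpace ℂ γ => v (φ i).2) (hψ p.2)
    rw [Matrix.toLpLin_apply] at this
    simpa [Matrix.mulVec, dotProduct] using this
  by_cases hi : (φ i).1 = p.1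
  · simp only [hi, if_true]
    rw [h2]
    ring
  · simp [hi]

end Product

/-! ### Boxes -/

variable {ν d : ℕ}

theorem mem_box {j₀ j : Fin d → ℤ} {N : ℕ} : j ∈ box j₀ N ↔ ∀ k, |j k - j₀ k| ≤ N := by
  simp only [box, Finset.mem_Icc, Pi.le_def, ← forall_and, abs_le]
  exact forall_congr' fun k => by constructor <;> rintro ⟨h1, h2⟩ <;> constructor <;> linarith

theorem card_box (j₀ : Fin d → ℤ) (N : ℕ) : (box j₀ N).card = (2 * N + 1) ^ d := by
  rw [box, Pi.card_Icc]
  simp only [Int.card_Icc]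
  rw [Finset.prod_congr rfl fun k _ => show (j₀ k + N + 1 - (j₀ k - N)).toNat = 2 * N + 1 by omega]
  simp

theorem self_mem_box (j₀ : Fin d → ℤ) (N : ℕ) : j₀ ∈ box j₀ N := mem_box.mpr fun k => by simp

theorem norm_intVec_le_iff {j : Fin d → ℤ} {n : ℕ} : ‖j‖ ≤ n ↔ ∀ k, |j k| ≤ n := by
  rw [pi_norm_le_iff_of_nonneg (Nat.cast_nonneg n)]
  refine forall_congr' fun k => ?_
  rw [Int.norm_eq_abs]
  exact_mod_cast Iff.rfl

theorem norm_intVec_lt_iff {j : Fin d → ℤ} {n : ℕ} (hn : 0 < n) : ‖j‖ < n ↔ ∀ k, |j k| < n := by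
  rw [pi_norm_lt_iff (Nat.cast_pos.mpr hn)]
  refine forall_congr' fun k => ?_
  rw [Int.norm_eq_abs]
  exact_mod_cast Iff.rfl

/-- A box whose boundary avoids the ball `{|j| < L}` either avoids this ball or contains
`{|j| ≤ L}`. -/
theorem box_dichotomy {j₀ : Fin d → ℤ} {L N : ℕ} (h : j₀ ∉ badCentres d L N) :
    (∀ j : Fin d → ℤ, ‖j‖ < L → j ∉ box j₀ N) ∨ ∀ j : Fin d → ℤ, ‖j‖ ≤ L → j ∈ box j₀ N := by
  by_contra! hcon
  obtain ⟨⟨j, hj, hjb⟩, p, hp, hpb⟩ := hcon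
  have hL : 0 < L := by
    have := (norm_nonneg j).trans_lt hj
    exact_mod_cast this
  rw [norm_intVec_lt_iff hL] at hj
  rw [norm_intVec_le_iff] at hp
  rw [mem_box] at hjb hpb
  push Not at hpb
  obtain ⟨k, hk⟩ := hpb
  -- Changing one coordinate of `j` to the face value `a` keeps the point in the box and in the
  -- ball, while the neighbour with value `a'` is outside the box: this is a boundary point too
  -- close to the origin. The face in question lies between `j k` and `p k`.
  have key : ∀ a a' : ℤ, |a - j₀ k| ≤ N → ¬ |a' - j₀ k| ≤ N → |a - a'| = 1 → |a| < L → False := by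
    intro a a' ha ha' haa hlt
    refine h ⟨Function.update j k a, ⟨?_, Function.update j k a', ?_, ?_⟩, ?_⟩
    · rw [Finset.mem_coe, mem_box]
      intro i
      by_cases hi : i = k
      · subst hi
        simpa using ha
      · simpa [hi] using hjb i
    · rw [Finset.mem_coe, mem_box]
      intro hall
      have := hall k
      rw [Function.update_self] at this
      exact ha' this
    · have : Function.update j k a - Function.update j k a' = Pi.single k (a - a') := by
        ext i
        by_cases hi : i = k
        · subst hi
          simp
        · simp [hi]
      rw [this, Pi.norm_single, Int.norm_eq_abs]
      exact_mod_cast haa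
    · rw [norm_intVec_lt_iff hL]
      intro i
      by_cases hi : i = k
      · subst hi
        simpa using hlt
      · simpa [hi] using hj i
  have h1 := hjb k
  have h2 := hj k
  have h3 := hp k
  rw [abs_le] at h1 h3
  rw [abs_lt] at h2
  rcases lt_abs.mp hk with h4 | h4
  · refine key (j₀ k + N) (j₀ k + N + 1) (by simp) ?_ (by simp) ?_
    · rw [abs_le]
      omega
    · rw [abs_lt]
      omega
  · refine key (j₀ k - N) (j₀ k - N - 1) (by simp) ?_ (by simp) ?_
    · rw [abs_le]
      omega
    · rw [abs_lt]
      omega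

theorem eigenvalues_eq_form {n : Type*} [Fintype n] [DecidableEq n] {M : Matrix n n ℂ}
    (hM : M.IsHermitian) (k : n) :
    hM.eigenvalues k = (inner ℂ (hM.eigenvectorBasis k)
      (Matrix.toEuclideanLin M (hM.eigenvectorBasis k))).re := by
  rw [hM.toEuclideanLin_eigenvectorBasis, inner_smul_right, inner_self_eq_norm_sq_to_K,
    hM.eigenvectorBasis.orthonormal.1 k]
  simp

theorem beta0_le_abs_eigenvalues {V : C(UnitAddTorus (Fin d), ℝ)} {L N : ℕ}
    (hL : IsSpectralRadius V L) {j₀ : Fin d → ℤ} (h : j₀ ∉ badCentres d L N) (k : box j₀ N) :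
    beta0 V ≤ |(schrodingerOn_isHermitian V (box j₀ N)).eigenvalues k| := by
  have hbd : ∀ j ∈ bdry (box j₀ N : Set (Fin d → ℤ)), (L : ℝ) ≤ ‖j‖ :=
    fun j hj => not_lt.mp fun hlt => h ⟨j, hj, hlt⟩
  obtain ⟨h1, h2⟩ := hL (box j₀ N) ⟨j₀, self_mem_box j₀ N⟩ hbd
  rcases box_dichotomy h with hd | hd
  · have h3 := (posSemidef_sub_smul_one_iff (schrodingerOn_isHermitian V (box j₀ N)) _).mp (h1 hd)
      ((schrodingerOn_isHermitian V (box j₀ N)).eigenvectorBasis k)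
    rw [← eigenvalues_eq_form,
      (schrodingerOn_isHermitian V (box j₀ N)).eigenvectorBasis.orthonormal.1 k] at h3
    exact (by linarith : beta0 V ≤ _).trans (le_abs_self _)
  · rcases (h2 hd).2 k with h3 | h3
    · exact (by linarith : beta0 V ≤ _).trans (neg_le_abs _)
    · exact h3.trans (le_abs_self _)

theorem eigenvalues_schrodingerOn_le (V : C(UnitAddTorus (Fin d), ℝ)) {B : Finset (Fin d → ℤ)}
    {R : ℝ} (hR : ∀ j ∈ B, euclSq j ≤ R) (k : B) :
    (schrodingerOn_isHermitian V B).eigenvalues k ≤ R + ‖mulOp V‖ := by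
  have h := form_section_le (torusBasis (Fin d)) (schrodingerOn_apply V B) hR
    ((schrodingerOn_isHermitian V B).eigenvectorBasis k)
  rwa [← eigenvalues_eq_form,
    (schrodingerOn_isHermitian V B).eigenvectorBasis.orthonormal.1 k, one_pow, mul_one] at h

end QPWave

end

noncomputable section

namespace QPWave

/-! ### Measure of planar sets from slices along lines through the origin -/

/-- Change of variables `θ = tη`: the Jacobian `t` is at most `3/2`, and `t ≥ 1/2` confines `η` to
`[-2R, 2R]`, of length `4R`. -/
theorem volume_le_of_slices {s : Set (ℝ × ℝ)} (hs : MeasurableSet s) {R : ℝ} {m : ℝ≥0∞}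
    (hLam : ∀ p ∈ s, p.1 ∈ Lam) (hR : ∀ p ∈ s, |p.2| ≤ R)
    (hm : ∀ η, volume {t | (t, t * η) ∈ s} ≤ m) :
    volume s ≤ ENNReal.ofReal (3 / 2) * (m * ENNReal.ofReal (4 * R)) := by
  let Φ : ℝ × ℝ → ℝ × ℝ := fun p => (p.1, p.1 * p.2)
  have hs' : MeasurableSet (Φ ⁻¹' s) := by
    have : Continuous Φ := by fun_prop
    exact this.measurable hs
  have h1 : ∀ t, volume (Prod.mk t ⁻¹' s)
      ≤ ENNReal.ofReal (3 / 2) * volume (Prod.mk t ⁻¹' (Φ ⁻¹' s)) := by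
    intro t
    by_cases ht : t ∈ Lam
    · have ht0 := Lam_pos ht
      have h2 : volume (Prod.mk t ⁻¹' (Φ ⁻¹' s))
          = ENNReal.ofReal |t⁻¹| * volume (Prod.mk t ⁻¹' s) := by
        have h4 : Prod.mk t ⁻¹' (Φ ⁻¹' s) = (fun x => t * x) ⁻¹' (Prod.mk t ⁻¹' s) := rfl
        rw [h4, Real.volume_preimage_mul_left ht0.ne']
      rw [h2, ← mul_assoc, ← ENNReal.ofReal_mul (by norm_num), abs_of_pos (inv_pos.mpr ht0)]
      refine le_mul_of_one_le_left zero_le ?_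
      rw [ENNReal.one_le_ofReal, ← div_eq_mul_inv, one_le_div ht0]
      exact ht.2
    · have : Prod.mk t ⁻¹' s = ∅ := by
        ext θ
        simp only [Set.mem_preimage, Set.mem_empty_iff_false, iff_false]
        exact fun h => ht (hLam _ h)
      simp [this]
  have h3 : ∀ η, volume ((fun t => (t, η)) ⁻¹' (Φ ⁻¹' s))
      ≤ (Set.Icc (-(2 * R)) (2 * R)).indicator (fun _ => m) η := by
    intro η
    by_cases hη : η ∈ Set.Icc (-(2 * R)) (2 * R)
    · rw [Set.indicator_of_mem hη]
      exact hm η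
    · have : (fun t => (t, η)) ⁻¹' (Φ ⁻¹' s) = ∅ := by
        ext t
        simp only [Set.mem_preimage, Set.mem_empty_iff_false, iff_false]
        intro h
        apply hη
        have ht := hLam _ h
        have h4 := hR _ h
        simp only [Φ] at ht h4
        rw [abs_mul, abs_of_pos (Lam_pos ht)] at h4
        exact abs_le.mp (by nlinarith [ht.1, abs_nonneg η])
      simp [this]
  calc volume s = ∫⁻ t, volume (Prod.mk t ⁻¹' s) := by
        rw [Measure.volume_eq_prod, Measure.prod_apply hs]
    _ ≤ ∫⁻ t, ENNReal.ofReal (3 / 2) * volume (Prod.mk t ⁻¹' (Φ ⁻¹' s)) := lintegral_mono h1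
    _ = ENNReal.ofReal (3 / 2) * volume (Φ ⁻¹' s) := by
        rw [lintegral_const_mul' _ _ ENNReal.ofReal_ne_top, Measure.volume_eq_prod,
          Measure.prod_apply hs']
    _ = ENNReal.ofReal (3 / 2) * ∫⁻ η, volume ((fun t => (t, η)) ⁻¹' (Φ ⁻¹' s)) := by
        rw [Measure.volume_eq_prod, Measure.prod_apply_symm hs']
    _ ≤ ENNReal.ofReal (3 / 2) * ∫⁻ η, (Set.Icc (-(2 * R)) (2 * R)).indicator (fun _ => m) η :=
        mul_le_mul_right (lintegral_mono h3) _
    _ = _ := by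
        rw [lintegral_indicator measurableSet_Icc, setLIntegral_const, Real.volume_Icc]
        ring_nf

/-- By homogeneity `x` may be taken on the unit sphere, so the set is the projection of a compact
set. This supplies the measurability needed for Fubini. -/
theorem isCompact_setOf_norm_apply_le {X σ : Type*} [TopologicalSpace X] [T2Space X] [Fintype σ]
    [DecidableEq σ] {s : Set X} (hs : IsCompact s) {M : X → Matrix σ σ ℂ}
    (hM : ∀ i k, ContinuousOn (fun p => M p i k) s) (δ : ℝ) :
    IsCompact {p ∈ s | ∃ x : EuclideanSpace ℂ σ, x ≠ 0 ∧
      ‖Matrix.toEuclideanLin (M p) x‖ ≤ δ * ‖x‖} := by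
  let t : Set (X × EuclideanSpace ℂ σ) := s ×ˢ Metric.sphere 0 1
  have ht : IsCompact t := hs.prod (isCompact_sphere _ _)
  have hcont : ContinuousOn (fun q : X × EuclideanSpace ℂ σ =>
      ‖Matrix.toEuclideanLin (M q.1) q.2‖) t := by
    refine ContinuousOn.norm ?_
    simp only [Matrix.toLpLin_apply]
    refine (PiLp.continuous_toLp 2 _).comp_continuousOn (continuousOn_pi.mpr fun i => ?_)
    simp only [Matrix.mulVec, dotProduct]
    refine continuousOn_finsetSum _ fun k _ => ContinuousOn.mul ?_ ?_
    · exact (hM i k).comp continuousOn_fst fun q hq => hq.1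
    · exact Continuous.continuousOn (by fun_prop)
  have hK : IsCompact {q ∈ t | ‖Matrix.toEuclideanLin (M q.1) q.2‖ ≤ δ} :=
    ht.of_isClosed_subset (hcont.preimage_isClosed_of_isClosed ht.isClosed isClosed_Iic)
      fun q hq => hq.1
  convert hK.image continuous_fst using 1
  ext p
  simp only [Set.mem_image, Set.mem_ofPred_eq, Prod.exists, exists_and_right, exists_eq_right]
  constructor
  · rintro ⟨hp, x, hx, hle⟩
    have hx0 : ‖x‖ ≠ 0 := norm_ne_zero_iff.mpr hx
    refine ⟨((‖x‖⁻¹ : ℝ) : ℂ) • x, ⟨hp, ?_⟩, ?_⟩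
    · rw [mem_sphere_zero_iff_norm, norm_smul, Complex.norm_real, norm_inv, norm_norm,
        inv_mul_cancel₀ hx0]
    · rw [map_smul, norm_smul, Complex.norm_real, norm_inv, norm_norm,
        inv_mul_le_iff₀ (by positivity)]
      linarith
  · rintro ⟨x, ⟨hp, hx⟩, hle⟩
    rw [mem_sphere_zero_iff_norm] at hx
    refine ⟨hp, x, ?_, by rwa [hx, mul_one]⟩
    rintro rfl
    simp at hx

/-! ### The matrices of the linearised wave operator -/

variable {ν d : ℕ}

theorem mFourierCoeff_one (n : Fin d → ℤ) :
    UnitAddTorus.mFourierCoeff (fun _ => (1 : ℂ)) n = if n = 0 then 1 else 0 := by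
  have h1 := orthonormal_iff_ite.mp (torusBasis (Fin d)).orthonormal n 0
  rw [inner_torusBasis] at h1
  rw [← h1, mFourierCoeff_eq_integral_torusMeasure, mFourierCoeff_eq_integral_torusMeasure]
  refine integral_congr_ae ?_
  filter_upwards [coeFn_torusBasis (0 : Fin d → ℤ)] with x hx
  rw [hx, UnitAddTorus.mFourier_zero]
  rfl

theorem mFourierCoeff_sub_mean (V : C(UnitAddTorus (Fin d), ℝ)) (n : Fin d → ℤ) :
    UnitAddTorus.mFourierCoeff (fun x => ((V x - mean V : ℝ) : ℂ)) n
      = UnitAddTorus.mFourierCoeff (fun x => (V x : ℂ)) n - if n = 0 then (mean V : ℂ) else 0 := by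
  have h1 := (coeffCLM n).map_sub V (mean V • 1)
  rw [map_smul] at h1
  have h2 : coeffCLM n (1 : C(UnitAddTorus (Fin d), ℝ)) = if n = 0 then 1 else 0 := by
    rw [← mFourierCoeff_one]
    simp [coeffCLM_apply]
  rw [h2] at h1
  have h3 : coeffCLM n (V - mean V • 1)
      = UnitAddTorus.mFourierCoeff (fun x => ((V x - mean V : ℝ) : ℂ)) n := by
    simp [coeffCLM_apply]
  rw [← h3, h1, coeffCLM_apply]
  split_ifs <;> simp

/-- The indices of a product box. -/
def boxEquiv (N : ℕ) (j₀ : Fin d → ℤ) :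
    (box (0 : Fin ν → ℤ) N ×ˢ box j₀ N : Finset (Idx ν d)) ≃ box (0 : Fin ν → ℤ) N × box j₀ N where
  toFun i := (⟨i.1.1, (Finset.mem_product.mp i.2).1⟩, ⟨i.1.2, (Finset.mem_product.mp i.2).2⟩)
  invFun p := ⟨(p.1.1, p.2.1), Finset.mem_product.mpr ⟨p.1.2, p.2.2⟩⟩
  left_inv _ := rfl
  right_inv _ := rfl

/-- The frequency `ω̄ · l`. -/
def freq (ω : Fin ν → ℝ) (l : Fin ν → ℤ) : ℝ := ∑ k, ω k * (l k : ℝ)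

theorem abs_freq_le {ω : Fin ν → ℝ} (hω : ∀ k, |ω k| ≤ 1) {N : ℕ} (l : box (0 : Fin ν → ℤ) N) :
    |freq ω l| ≤ ν * N := by
  calc |freq ω l| ≤ ∑ k, |ω k * (l.1 k : ℝ)| := Finset.abs_sum_le_sum_abs _ _
    _ ≤ ∑ _k : Fin ν, (N : ℝ) := by
      refine Finset.sum_le_sum fun k _ => ?_
      have h1 : |(l.1 k : ℝ)| ≤ N := by
        have := mem_box.mp l.2 k
        simp only [Pi.zero_apply, sub_zero] at this
        exact_mod_cast this
      rw [abs_mul]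
      calc |ω k| * |(l.1 k : ℝ)| ≤ 1 * N := mul_le_mul (hω k) h1 (abs_nonneg _) zero_le_one
        _ = N := one_mul _
    _ = _ := by simp

variable (V : C(UnitAddTorus (Fin d), ℝ)) (ω : Fin ν → ℝ)
  (g : ℝ → C(UnitAddTorus (Fin ν ⊕ Fin d), ℝ)) (ε : ℝ) (N : ℕ) (j₀ : Fin d → ℤ)

/-- The eigenbasis of the unperturbed operator on a box. -/
def boxBasis : OrthonormalBasis (box (0 : Fin ν → ℤ) N × box j₀ N) ℂ
    (EuclideanSpace ℂ (box (0 : Fin ν → ℤ) N ×ˢ box j₀ N : Finset (Idx ν d))) :=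
  productBasis (boxEquiv N j₀) (schrodingerOn_isHermitian V (box j₀ N)).eigenvectorBasis

/-- The mean `m` on the diagonal and `T₂` recombine into `V`; without `T₁` the matrix acts as a
scalar in `l` plus the compression of `-Δ + V` in `j`. -/
theorem toEuclideanLin_boxMatrix (lam θ : ℝ)
    (x : EuclideanSpace ℂ (box (0 : Fin ν → ℤ) N ×ˢ box j₀ N : Finset (Idx ν d))) :
    Matrix.toEuclideanLin (boxMatrix V ω g ε N j₀ lam θ) x
      = (boxBasis V N j₀).diagonalOp (fun p => -(lam * freq ω p.1 + θ) ^ 2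
          + (schrodingerOn_isHermitian V (box j₀ N)).eigenvalues p.2) x
        - (ε : ℂ) • Matrix.toEuclideanLin (mulSection _ (g lam)) x := by
  have h1 : boxMatrix V ω g ε N j₀ lam θ
      = (boxMatrix V ω g ε N j₀ lam θ + (ε : ℂ) • mulSection _ (g lam))
        - (ε : ℂ) • mulSection _ (g lam) := by rw [add_sub_cancel_right]
  rw [h1, map_sub, map_smul, LinearMap.sub_apply, LinearMap.smul_apply,
    toEuclideanLin_eq_diagonalOp (boxEquiv N j₀) _
      (schrodingerOn_isHermitian V (box j₀ N)).toEuclideanLin_eigenvectorBasis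
      (fun l => -(lam * freq ω l + θ) ^ 2) ?_]
  · rfl
  intro i k
  obtain ⟨⟨l, j⟩, hi⟩ := i
  obtain ⟨⟨l', j'⟩, hk⟩ := k
  simp only [boxMatrix, fullMatrix, diagPart, T2, Matrix.add_apply, Matrix.sub_apply,
    Matrix.submatrix_apply, Matrix.smul_apply, mulSection, boxEquiv,
    Equiv.coe_fn_mk, schrodingerOn, schrodinger, Matrix.diagonal_apply, Subtype.mk.injEq,
    Prod.mk.injEq, mFourierCoeff_sub_mean, sub_eq_zero]
  rw [← add_sub_assoc, sub_add_cancel]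
  by_cases hl : l = l'
  · by_cases hj : j = j'
    · simp only [hl, hj, and_self, if_true, freq]
      push_cast
      ring
    · simp [hl, hj]
  · simp [hl]

theorem card_boxBasis_index : Fintype.card (box (0 : Fin ν → ℤ) N × box j₀ N)
    = (2 * N + 1) ^ ν * (2 * N + 1) ^ d := by
  rw [Fintype.card_prod, Fintype.card_coe, Fintype.card_coe, card_box, card_box]

theorem continuousOn_boxMatrix {g : ℝ → C(UnitAddTorus (Fin ν ⊕ Fin d), ℝ)}
    (hg : ContinuousOn g Lam) (i k) :
    ContinuousOn (fun p : ℝ × ℝ => boxMatrix V ω g ε N j₀ p.1 p.2 i k) {p | p.1 ∈ Lam} := by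
  have h1 : ContinuousOn (fun p : ℝ × ℝ => mulMatrix (g p.1) i.1 k.1) {p | p.1 ∈ Lam} :=
    (coeffCLM (Sum.elim (i.1.1 - k.1.1) (i.1.2 - k.1.2))).continuous.comp_continuousOn
      (hg.comp continuousOn_fst fun p hp => hp)
  have h2 : Continuous fun p : ℝ × ℝ => diagPart V ω p.1 p.2 i.1 k.1 := by
    simp only [diagPart, Matrix.diagonal_apply]
    split_ifs <;> fun_prop
  exact h2.continuousOn.add (continuousOn_const.sub (h1.const_smul (ε : ℂ)))

end QPWave

end

/-! ### Invertibility for large `θ`, and the measure of one slice. -/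

noncomputable section

namespace QPWave

variable {ν d : ℕ}

theorem euclSq_le_of_mem_box {j₀ j : Fin d → ℤ} {N : ℕ} (hj₀ : ‖j₀‖ < 8 * N)
    (hj : j ∈ box j₀ N) : euclSq j ≤ 81 * d * (N : ℝ) ^ 2 := by
  have h1 : ‖j - j₀‖ ≤ N := norm_intVec_le_iff.mpr (mem_box.mp hj)
  have h2 : ‖j‖ ≤ 9 * N := by
    have := norm_add_le (j - j₀) j₀
    rw [sub_add_cancel] at this
    linarith
  calc euclSq j ≤ d * ‖j‖ ^ 2 := euclSq_le j
    _ ≤ d * (9 * N) ^ 2 := by gcongr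
    _ = _ := by ring

/-- A constant `a` such that the box matrices are invertible for `|θ| > a N`. -/
def thetaBound (ν : ℕ) (V : C(UnitAddTorus (Fin d), ℝ)) (c : ℝ) : ℝ :=
  3 / 2 * ν + (9 * d + (‖mulOp V‖ + c + 3))

theorem thetaBound_pos (ν : ℕ) (V : C(UnitAddTorus (Fin d), ℝ)) {c : ℝ} (hc : 0 ≤ c) :
    0 < thetaBound ν V c := by
  unfold thetaBound
  positivity

theorem two_mul_norm_lt (V : C(UnitAddTorus (Fin d), ℝ)) {ω : Fin ν → ℝ} (hω : ∀ k, |ω k| ≤ 1)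
    (g : ℝ → C(UnitAddTorus (Fin ν ⊕ Fin d), ℝ)) {ε c : ℝ} (hε : 0 ≤ ε) (hc : 0 ≤ c) {lam θ : ℝ}
    (hlam : lam ∈ Lam)
    (hg : ENNReal.ofReal ε * opNorm (mulMatrix (g lam)) ≤ ENNReal.ofReal c) {N : ℕ} (hN : 1 ≤ N)
    {j₀ : Fin d → ℤ} (hj₀ : ‖j₀‖ < 8 * N) (hθ : thetaBound ν V c * N < |θ|)
    {x : EuclideanSpace ℂ (box (0 : Fin ν → ℤ) N ×ˢ box j₀ N : Finset (Idx ν d))} (hx : x ≠ 0) :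
    2 * ‖x‖ < ‖Matrix.toEuclideanLin (boxMatrix V ω g ε N j₀ lam θ) x‖ := by
  have hN1 : (1 : ℝ) ≤ N := by exact_mod_cast hN
  set q := ‖mulOp V‖ + c + 3 with hq
  have hq1 : 1 ≤ q := by
    have := norm_nonneg (mulOp V)
    linarith
  set D := (boxBasis (ν := ν) V N j₀).diagonalOp (fun p => -(lam * freq ω p.1 + θ) ^ 2
    + (schrodingerOn_isHermitian V (box j₀ N)).eigenvalues p.2) with hD
  have hentry : ∀ p : box (0 : Fin ν → ℤ) N × box j₀ N, -(lam * freq ω p.1 + θ) ^ 2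
      + (schrodingerOn_isHermitian V (box j₀ N)).eigenvalues p.2 ≤ -(c + 3) := by
    intro p
    have h1 := eigenvalues_schrodingerOn_le V (fun j hj => euclSq_le_of_mem_box hj₀ hj) p.2
    have h2 : |lam * freq ω p.1| ≤ 3 / 2 * (ν * N) := by
      rw [abs_mul, abs_of_pos (Lam_pos hlam)]
      exact mul_le_mul hlam.2 (abs_freq_le hω p.1) (abs_nonneg _) (by norm_num)
    have h3 : (9 * d + q) * N ≤ |lam * freq ω p.1 + θ| := by
      have h4 : |θ| - |lam * freq ω p.1| ≤ |lam * freq ω p.1 + θ| := by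
        have := abs_sub_abs_le_abs_sub θ (-(lam * freq ω p.1))
        rwa [abs_neg, sub_neg_eq_add, add_comm θ] at this
      have h5 : thetaBound ν V c * N = 3 / 2 * (ν * N) + (9 * d + q) * N := by
        rw [thetaBound]
        ring
      linarith
    have h6 : ((9 * d + q) * N) ^ 2 ≤ (lam * freq ω p.1 + θ) ^ 2 := by
      rw [← sq_abs (lam * freq ω p.1 + θ)]
      exact pow_le_pow_left₀ (by positivity) h3 2
    -- Here `81 d N²` bounds `‖j‖²` on the box, since `|j| ≤ 9N`, and `q = ‖V‖ + c + 3` absorbs the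
    -- potential and leaves entries at most `-(c + 3)`. After a perturbation of norm at most `c`
    -- there remains `3 > 2`.
    have h7 : 81 * (d : ℝ) * N ^ 2 + q ≤ ((9 * d + q) * N) ^ 2 := by
      have h8 : (d : ℝ) ≤ (d : ℝ) ^ 2 := by
        have : d ≤ d ^ 2 := Nat.le_self_pow two_ne_zero d
        exact_mod_cast this
      have h9 : (1 : ℝ) ≤ (N : ℝ) ^ 2 := one_le_pow₀ hN1
      have h10 : q * 1 ≤ q ^ 2 * (N : ℝ) ^ 2 :=
        mul_le_mul (by nlinarith) h9 zero_le_one (sq_nonneg _)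
      have h11 : (d : ℝ) * N ^ 2 ≤ (d : ℝ) ^ 2 * N ^ 2 :=
        mul_le_mul_of_nonneg_right h8 (sq_nonneg _)
      have h12 : 0 ≤ (d : ℝ) * q * N ^ 2 := by positivity
      nlinarith
    linarith
  have h1 : (c + 3) * ‖x‖ ≤ ‖D x‖ := by
    refine abs_le_of_sq_le_sq' ?_ (norm_nonneg _) |>.2
    rw [hD, (boxBasis V N j₀).norm_apply_sq_of_diagonal
      ((boxBasis V N j₀).diagonalOp_apply_basis _), mul_pow,
      ← (boxBasis V N j₀).sum_sq_norm_inner_right, Finset.mul_sum]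
    refine Finset.sum_le_sum fun p _ => mul_le_mul_of_nonneg_right ?_ (sq_nonneg _)
    have := hentry p
    nlinarith
  have h2 := mul_norm_section_le hε hc hg _ x
  have hx0 := norm_pos_iff.mpr hx
  rw [toEuclideanLin_boxMatrix]
  have h3 := norm_sub_norm_le (D x) ((ε : ℂ) • Matrix.toEuclideanLin (mulSection _ (g lam)) x)
  rw [norm_smul, Complex.norm_real, Real.norm_of_nonneg hε] at h3
  have h4 : ε * ‖Matrix.toEuclideanLin (mulSection _ (g lam)) x‖ ≤ c * ‖x‖ := h2
  linarith

/-- On the line `θ = tη` one has `(tω·l + θ)² = t²(ω·l + η)²`, which is the form treated by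
`volume_setOf_norm_perturbed_apply_le` with `y = (ω·l + η)²`. -/
theorem volume_slice_le (V : C(UnitAddTorus (Fin d), ℝ)) (hV : TrivialKernel V)
    (ω : Fin ν → ℝ) {g : ℝ → C(UnitAddTorus (Fin ν ⊕ Fin d), ℝ)} (hg : ContDiffOn ℝ 1 g Lam)
    {ε : ℝ} (hε : 0 ≤ ε)
    (hgc : ∀ lam ∈ Lam, ENNReal.ofReal ε *
      (opNorm (mulMatrix (g lam)) + opNorm (mulMatrix (derivWithin g Lam lam)))
        ≤ ENNReal.ofReal (beta0 V / 240)) {L N : ℕ} (hL : IsSpectralRadius V L)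
    {j₀ : Fin d → ℤ} (hj₀ : j₀ ∉ badCentres d L N) {δ : ℝ} (hδ : 0 ≤ δ) (η : ℝ) :
    volume {t ∈ Lam | ∃ x, x ≠ 0 ∧
      ‖Matrix.toEuclideanLin (boxMatrix V ω g ε N j₀ t (t * η)) x‖ ≤ δ * ‖x‖}
      ≤ ((2 * N + 1) ^ ν * (2 * N + 1) ^ d : ℕ) * ENNReal.ofReal (96 * δ / beta0 V) := by
  have hβ := beta0_pos V hV
  have hc : 0 ≤ beta0 V / 240 := by positivity
  rw [← card_boxBasis_index (ν := ν) N j₀]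
  refine volume_setOf_norm_perturbed_apply_le (boxBasis V N j₀)
    (y := fun p => (freq ω p.1 + η) ^ 2)
    (h := fun p => (schrodingerOn_isHermitian V (box j₀ N)).eigenvalues p.2)
    (c := beta0 V / 240)
    (T := fun t => (ε : ℂ) • Matrix.toEuclideanLin (mulSection _ (g t))) hβ hδ
    (fun p => sq_nonneg _) (fun p => beta0_le_abs_eigenvalues hL hj₀ p.2) (by linarith) hc
    ?_ ?_ ?_ ?_
  · intro t _ x z
    rw [LinearMap.smul_apply, LinearMap.smul_apply, inner_smul_left, inner_smul_right,
      Complex.conj_ofReal,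
      Matrix.isSymmetric_toEuclideanLin_iff.mpr (mulSection_isHermitian _ (g t)) x z]
  · intro t ht x
    rw [LinearMap.smul_apply, norm_smul, Complex.norm_real, Real.norm_of_nonneg hε]
    exact mul_norm_section_le hε hc ((mul_le_mul_right le_self_add _).trans (hgc t ht)) _ x
  · intro t ht t' ht' x
    have h1 := abs_form_sub_le _ hε hc hg
      (fun s hs => (mul_le_mul_right le_add_self _).trans (hgc s hs)) ht ht' x
    rw [LinearMap.smul_apply, LinearMap.smul_apply, inner_smul_right, inner_smul_right,
      Complex.re_ofReal_mul, Complex.re_ofReal_mul, ← mul_sub, abs_mul, abs_of_nonneg hε]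
    exact h1
  · intro t _ x
    rw [toEuclideanLin_boxMatrix, LinearMap.smul_apply]
    congr 3
    ext p
    ring

end QPWave

end

/-! ### Assembly of the measure estimate. -/

open QPWave in
theorem mainTheorem6 (d ν : ℕ) (hd : 1 ≤ d) (hν : 1 ≤ ν) (τ : ℝ) (hτ : 0 < τ)
    (V : C(UnitAddTorus (Fin d), ℝ)) (hV : TrivialKernel V) :
    (∃ L : ℕ, IsSpectralRadius V L) ∧
    ∃ c : ℝ, 0 < c ∧ ∃ C : ℝ, 0 < C ∧ ∃ N₀ : ℕ,
      ∀ ω : Fin ν → ℝ, (∀ k, |ω k| ≤ 1) →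
      ∀ ε : ℝ, 0 ≤ ε →
      ∀ g : ℝ → C(UnitAddTorus (Fin ν ⊕ Fin d), ℝ), ContDiffOn ℝ 1 g Lam →
      (∀ lam ∈ Lam, ENNReal.ofReal ε *
        (opNorm (mulMatrix (g lam)) + opNorm (mulMatrix (derivWithin g Lam lam)))
          ≤ ENNReal.ofReal c) →
      ∀ L : ℕ, IsSpectralRadius V L →
      ∀ N : ℕ, N₀ ≤ N →
      ∀ j₀ : Fin d → ℤ, ‖j₀‖ < 8 * N → j₀ ∉ badCentres d L N →
        volume {p : ℝ × ℝ | p.1 ∈ Lam ∧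
            ENNReal.ofReal ((N : ℝ) ^ τ / 2) < invNorm (boxMatrix V ω g ε N j₀ p.1 p.2)}
          ≤ ENNReal.ofReal (C * (N : ℝ) ^ (-τ + d + ν + 1)) := by
  have hβ := beta0_pos V hV
  have hc : 0 < beta0 V / 240 := by positivity
  set a := thetaBound ν V (beta0 V / 240) with ha
  have ha0 : 0 < a := thetaBound_pos ν V hc.le
  -- In the constant, `3/2` is the Jacobian, the powers of `3` come from `2N + 1 ≤ 3N`, the factor
  -- `96 * 2 / β₀` is the slice bound with `δ = 2N^(-τ)`, and `4aN` is the length of the range of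
  -- `η`.
  refine ⟨exists_isSpectralRadius V hV, beta0 V / 240, hc,
    3 / 2 * (3 ^ ν * 3 ^ d * (96 * 2 / beta0 V) * (4 * a)), by positivity, 1, ?_⟩
  intro ω hω ε hε g hg hgc L hL N hN j₀ hj₀ hj₀'
  have hN1 : (1 : ℝ) ≤ N := by exact_mod_cast hN
  have hN0 : (0 : ℝ) < N := by linarith
  have hK : 0 < (N : ℝ) ^ τ / 2 := by positivity
  set δ := ((N : ℝ) ^ τ / 2)⁻¹ with hδ
  have hδ2 : δ ≤ 2 := by
    rw [hδ, inv_div]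
    exact div_le_self zero_le_two (Real.one_le_rpow hN1 hτ.le)
  have hδeq : δ = 2 * (N : ℝ) ^ (-τ) := by
    rw [hδ, inv_div, Real.rpow_neg hN0.le, div_eq_mul_inv]
  -- A compact superset replaces the bad set, whose own measurability is then irrelevant.
  set s : Set (ℝ × ℝ) := {p ∈ Lam ×ˢ Set.Icc (-(a * N)) (a * N) | ∃ x, x ≠ 0 ∧
    ‖Matrix.toEuclideanLin (boxMatrix V ω g ε N j₀ p.1 p.2) x‖ ≤ δ * ‖x‖} with hs
  have hscompact : IsCompact s :=
    isCompact_setOf_norm_apply_le (isCompact_Icc.prod isCompact_Icc)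
      (fun i k => (continuousOn_boxMatrix V ω ε N j₀ hg.continuousOn i k).mono fun p hp => hp.1) δ
  have hsub : {p : ℝ × ℝ | p.1 ∈ Lam ∧
      ENNReal.ofReal ((N : ℝ) ^ τ / 2) < invNorm (boxMatrix V ω g ε N j₀ p.1 p.2)} ⊆ s := by
    rintro ⟨lam, θ⟩ ⟨hlam, hinv⟩
    obtain ⟨x, hx, hle⟩ := exists_norm_le_of_lt_invNorm hK hinv
    -- For `|θ| > aN` the lower bound `‖Ax‖ > 2‖x‖` contradicts `‖Ax‖ ≤ δ‖x‖`, because `δ ≤ 2`.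
    refine ⟨⟨hlam, abs_le.mp (not_lt.mp fun hθ => ?_)⟩, x, hx, hle⟩
    have h1 := two_mul_norm_lt V hω g hε hc.le hlam
      ((mul_le_mul_right le_self_add _).trans (hgc lam hlam)) hN hj₀ hθ hx
    have h2 := mul_le_mul_of_nonneg_right hδ2 (norm_nonneg x)
    exact absurd (hle.trans h2) (not_le.mpr h1)
  have hslices := volume_le_of_slices hscompact.measurableSet (fun p hp => hp.1.1)
    (fun p hp => abs_le.mpr hp.1.2) fun η => by
      refine le_trans (measure_mono ?_)
        (volume_slice_le V hV ω hg hε hgc hL hj₀' (inv_nonneg.mpr hK.le) η)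
      exact fun t ht => ⟨ht.1.1, ht.2⟩
  refine (measure_mono hsub).trans (hslices.trans ?_)
  rw [← ENNReal.ofReal_natCast, ← ENNReal.ofReal_mul (Nat.cast_nonneg _),
    ← ENNReal.ofReal_mul (by positivity), ← ENNReal.ofReal_mul (by norm_num)]
  refine ENNReal.ofReal_le_ofReal ?_
  have hpow : (N : ℝ) ^ (-τ + d + ν + 1) = (N : ℝ) ^ (-τ) * (N : ℝ) ^ d * (N : ℝ) ^ ν * N := by
    rw [Real.rpow_add hN0, Real.rpow_add hN0, Real.rpow_add hN0, Real.rpow_natCast,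
      Real.rpow_natCast, Real.rpow_one]
  have h3 : (2 * (N : ℝ) + 1) ≤ 3 * N := by linarith
  have hcard : (((2 * N + 1) ^ ν * (2 * N + 1) ^ d : ℕ) : ℝ)
      ≤ (3 * (N : ℝ)) ^ ν * (3 * (N : ℝ)) ^ d := by
    push_cast
    gcongr
  calc 3 / 2 * (((2 * N + 1) ^ ν * (2 * N + 1) ^ d : ℕ) * (96 * δ / beta0 V) * (4 * (a * N)))
      ≤ 3 / 2 * ((3 * (N : ℝ)) ^ ν * (3 * (N : ℝ)) ^ d * (96 * δ / beta0 V) * (4 * (a * N))) := by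
        gcongr
    _ = _ := by
        rw [hδeq, hpow, mul_pow, mul_pow]
        ring
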